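/- Let $U\subseteq\mathbb R^4$ be a coordinate domain of a space-time with smooth Lorentzian metric $g$ and Levi-Civita connection $\nabla$, and let $(e_1,e_2,e_3,e_4)=(m,\overline m,\ell,k)$ be a smooth Newman–Penrose null tetrad on $U$ ($k,\ell$ real, $m\cdot\overline m=1$, $k\cdot\ell=-1$, all other products zero). Put $\Gamma_{abc}=e_a\cdot\nabla_{e_c}e_b$, $D=k^a\partial_a$, $\Delta=\ell^a\partial_a$, $\delta=m^a\partial_a$, and $\kappa=-\Gamma_{144}=-k_{a;b}m^ak^b$, $\rho=-\Gamma_{142}$, $\sigma=-\Gamma_{141}$, $\tau=-\Gamma_{143}$, $\nu=\Gamma_{233}$, $\mu=\Gamma_{231}$, $\lambda=\Gamma_{232}$, $\pi=\Gamma_{234}$, $\varepsilon=-\tfrac12(\Gamma_{344}-\Gamma_{214})$, $\beta=-\tfrac12(\Gamma_{341}-\Gamma_{211})$, $\gamma=\tfrac12(\Gamma_{433}-\Gamma_{123})$, $\alpha=\tfrac12(\Gamma_{432}-\Gamma_{122})$. Let $R_{abcd}$ be the tetrad components of a smooth real tensor field with the algebraic symmetries of a Riemann tensor (an independent variable, not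 assumed to be the curvature of $g$), with $R_{bd}=R^c{}_{bcd}$, $R=R^b{}_b$, Weyl part $C_{abcd}$, and $\Psi_0=C_{4141}$, $\Psi_1=C_{4341}$, $\Psi_2=C_{4123}$, $\Psi_3=C_{4323}$, $\Psi_4=C_{2323}$, $\Phi_{00}=\tfrac12R_{44}$, $\Phi_{01}=\overline{\Phi_{10}}=\tfrac12R_{41}$, $\Phi_{02}=\overline{\Phi_{20}}=\tfrac12R_{11}$, $\Phi_{11}=\tfrac14(R_{43}+R_{12})$, $\Phi_{12}=\overline{\Phi_{21}}=\tfrac12R_{31}$, $\Phi_{22}=\tfrac12R_{33}$. The Newman–Penrose equations $NP_1,\dots,NP_{18}$ are the equations 1. $D\rho-\overline\delta\kappa=\rho^2+\sigma\overline\sigma+(\varepsilon+\overline\varepsilon)\rho-\overline\kappa\tau-\kappa(3\alpha+\overline\beta-\pi)+\Phi_{00}$ 2. $D\sigma-\delta\kappa=(\rho+\overline\rho)\sigma+(3\varepsilon-\overline\varepsilon)\sigma-(\tau-\overline\pi+\overline\alpha+3\beta)\kappa+\Psi_0$ 3. $D\tau-\Delta\kappa=(\tau+\overline\pi)\rho+(\overline\tau+\pi)\sigma+(\varepsilon-\overline\varepsilon)\tau-(3\gamma+\overline\gamma)\kappa+\Psi_1+\Phi_{01}$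 4. $D\alpha-\overline\delta\varepsilon=(\rho+\overline\varepsilon-2\varepsilon)\alpha+\beta\overline\sigma-\overline\beta\varepsilon-\kappa\lambda-\overline\kappa\gamma+(\varepsilon+\rho)\pi+\Phi_{10}$ 5. $D\beta-\delta\varepsilon=(\alpha+\pi)\sigma+(\overline\rho-\overline\varepsilon)\beta-(\mu+\gamma)\kappa-(\overline\alpha-\overline\pi)\varepsilon+\Psi_1$ 6. $D\gamma-\Delta\varepsilon=(\tau+\overline\pi)\alpha+(\overline\tau+\pi)\beta-(\varepsilon+\overline\varepsilon)\gamma-(\gamma+\overline\gamma)\varepsilon+\tau\pi-\nu\kappa+\Psi_2+\Phi_{11}-R/24$ 7. $D\lambda-\overline\delta\pi=\rho\lambda+\overline\sigma\mu+\pi^2+(\alpha-\overline\beta)\pi-\nu\overline\kappa-(3\varepsilon-\overline\varepsilon)\lambda+\Phi_{20}$ 8. $D\mu-\delta\pi=\overline\rho\mu+\sigma\lambda+\pi\overline\pi-(\varepsilon+\overline\varepsilon)\mu-\pi(\overline\alpha-\beta)-\kappa\nu+\Psi_2+R/12$ 9. $D\nu-\Delta\pi=(\pi+\overline\tau)\mu+(\overline\pi+\tau)\lambda+(\gamma-\overline\gamma)\pi-(3\varepsilon+\overline\varepsilon)\nu+\Psi_3+\Phi_{21}$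 10. $\Delta\lambda-\overline\delta\nu=-(\mu+\overline\mu)\lambda-(3\gamma-\overline\gamma)\lambda+(3\alpha+\overline\beta+\pi-\overline\tau)\nu-\Psi_4$ 11. $\delta\rho-\overline\delta\sigma=\rho(\overline\alpha+\beta)-\sigma(3\alpha-\overline\beta)+(\rho-\overline\rho)\tau+(\mu-\overline\mu)\kappa-\Psi_1+\Phi_{01}$ 12. $\delta\alpha-\overline\delta\beta=\mu\rho-\lambda\sigma+\alpha\overline\alpha+\beta\overline\beta-2\alpha\beta+\gamma(\rho-\overline\rho)+\varepsilon(\mu-\overline\mu)-\Psi_2+\Phi_{11}+R/24$ 13. $\delta\lambda-\overline\delta\mu=(\rho-\overline\rho)\nu+(\mu-\overline\mu)\pi+\mu(\alpha+\overline\beta)+\lambda(\overline\alpha-3\beta)-\Psi_3+\Phi_{21}$ 14. $\delta\nu-\Delta\mu=\mu^2+\lambda\overline\lambda+(\gamma+\overline\gamma)\mu-\overline\nu\pi+(\tau-3\beta-\overline\alpha)\nu+\Phi_{22}$ 15. $\delta\gamma-\Delta\beta=(\tau-\overline\alpha-\beta)\gamma+\mu\tau-\sigma\nu-\varepsilon\overline\nu-\beta(\gamma-\overline\gamma-\mu)+\alpha\overline\lambda+\Phi_{12}$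 16. $\delta\tau-\Delta\sigma=\mu\sigma+\overline\lambda\rho+(\tau+\beta-\overline\alpha)\tau-(3\gamma-\overline\gamma)\sigma-\kappa\overline\nu+\Phi_{02}$ 17. $\Delta\rho-\overline\delta\tau=-(\rho\overline\mu+\sigma\lambda)+(\overline\beta-\alpha-\overline\tau)\tau+(\gamma+\overline\gamma)\rho+\nu\kappa-\Psi_2-R/12$ 18. $\Delta\alpha-\overline\delta\gamma=(\rho+\varepsilon)\nu-(\tau+\beta)\lambda+(\overline\gamma-\overline\mu)\alpha+(\overline\beta-\overline\tau)\gamma-\Psi_3$ and $NP_n$ also denotes left-hand side minus right-hand side. The field equations are (F) $NP_{10}$, $NP_{13}$, $NP_{12}+\overline{NP_{12}}$, $NP_{14}+\overline{NP_{14}}$; the remaining Newman–Penrose equations are (J) $\overline{NP_1}-NP_1$, $\overline{NP_{14}}-NP_{14}$, $\overline{NP_{12}}+\overline{NP_8}-NP_{12}-NP_8$, $\overline{NP_6}-NP_6+NP_8-\overline{NP_8}$, $NP_{16}-\overline{NP_7}$, $NP_{17}+NP_8$, $2NP_4-\overline{NP_3}-\overline{NP_{11}}$, $2NP_5-NP_3+NP_{11}$,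 $2NP_{15}-\overline{NP_9}-\overline{NP_{13}}$, $2NP_{18}+NP_9-NP_{13}$, and (R) $NP_1$, $NP_2$, $NP_3$, $NP_{11}$, $NP_{16}$, $NP_{17}$, $\overline{NP_4}+NP_5$, $NP_{15}-\overline{NP_{18}}$, $\overline{NP_6}+NP_6$, $\overline{NP_{12}}-NP_{12}$, each expression being equated to zero. The Bianchi equations are $R_{ab[cd;e]}=0$. **Theorem.** (i) For arbitrary smooth tetrad $(m,\overline m,\ell,k)$, $\Gamma_{abc}$ (with $\Gamma_{(ab)c}=0$ and the reality property) and $R_{abcd}$, regarded as independent variables, with $\gamma^c{}_{ab}=\Gamma^c{}_{ba}-\Gamma^c{}_{ab}$: at each point $NP_1,\dots,NP_{18}$ together are equivalent to the second Cartan equations; (J) is equivalent to the Jacobi equations $e_{[a}\gamma^d{}_{bc]}-\gamma^d{}_{e[a}\gamma^e{}_{bc]}=0$; (R) is equivalent to the Ricci equations $k^a{}_{;c;d}-k^a{}_{;d;c}=R^a{}_{bdc}k^b$ for $k$; and $NP_1,\dots,NP_{18}$ together are equivalent to (J), (R) and (F) together. (ii) If $\kappa\neq0$ on $U$, then (F)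 are integrability conditions of the remaining Newman–Penrose equations together with the Bianchi equations: whenever $g$, the null tetrad and $R_{abcd}$ satisfy (J), (R) and the Bianchi equations on $U$, they satisfy (F) on $U$. (iii) The equations (F) are not algebraic consequences of those equations: at a point where the variables of (i), with linearly independent tetrad, satisfy the commutator relations $[e_a,e_b]=\gamma^c{}_{ab}e_c$, (J), (R), the Bianchi equations and $\kappa\ne0$, the expressions in (F) can take arbitrary values in $\mathbb C\times\mathbb C\times\mathbb R\times\mathbb R$. -/

import Mathlib

open scoped ContDiff

noncomputable section

namespace NewmanPenrose

/-! ### Calculus on a coordinate domain -/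

/-- Points of a coordinate domain of space-time. -/
abbrev Coord := Fin 4 → ℝ

/-- Complex scalar fields. -/
abbrev Scalar := Coord → ℂ

/-- Complex vector fields, given by their coordinate components. -/
abbrev VecField := Coord → Fin 4 → ℂ

/-- The directional derivative `v(f) = v ^ i ∂ᵢ f` along a complex vector field. -/
def dirDeriv (v : VecField) (f : Scalar) : Scalar :=
  fun x => ∑ i, v x i * fderiv ℝ f x (Pi.single i 1)

/-! ### Metric and Levi-Civita connection in coordinates -/

/-- The Christoffel symbols
`Γ^i_{jk} = (1/2) g^{il} (∂_j g_{lk} + ∂_k g_{lj} - ∂_l g_{jk})`. -/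
def christoffel (g : Coord → Matrix (Fin 4) (Fin 4) ℝ) (i j k : Fin 4) (x : Coord) : ℝ :=
  (1 / 2) * ∑ l, (g x)⁻¹ i l *
    (fderiv ℝ (fun y => g y l k) x (Pi.single j 1)
      + fderiv ℝ (fun y => g y l j) x (Pi.single k 1)
      - fderiv ℝ (fun y => g y j k) x (Pi.single l 1))

/-- The covariant derivative `∇_V W` of the Levi-Civita connection of `g`. -/
def covDeriv (g : Coord → Matrix (Fin 4) (Fin 4) ℝ) (V W : VecField) : VecField :=
  fun x i => dirDeriv V (fun y => W y i) x
    + ∑ j, ∑ k, (christoffel g i j k x : ℂ) * V x j * W x k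

/-- The complex-bilinear extension of the metric. -/
def metricInner (g : Coord → Matrix (Fin 4) (Fin 4) ℝ) (V W : VecField) : Scalar :=
  fun x => ∑ i, ∑ j, (g x i j : ℂ) * V x i * W x j

/-! ### Null tetrads -/

/-- The constant tetrad metric `g_{ab} = e_a · e_b` of a null tetrad `(m, m̄, ℓ, k)`:
`m · m̄ = 1`, `ℓ · k = -1`, all other products zero. This matrix is its own inverse. -/
def eta : Matrix (Fin 4) (Fin 4) ℂ :=
  !![0, 1, 0, 0; 1, 0, 0, 0; 0, 0, 0, -1; 0, 0, -1, 0]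

/-- Complex conjugation exchanges the tetrad vectors `m` and `m̄`, and fixes `ℓ` and `k`. -/
def conjIdx : Fin 4 → Fin 4 := ![1, 0, 2, 3]

/-- The data of a tetrad: a complex vector field `m` and real vector fields `ℓ`, `k`. -/
structure Tetrad where
  m : VecField
  l : Coord → Fin 4 → ℝ
  k : Coord → Fin 4 → ℝ

/-- The tetrad vectors `e_1, …, e_4 = m, m̄, ℓ, k` (numbered from `0` to `3` here). -/
def Tetrad.e (t : Tetrad) : Fin 4 → VecField :=
  ![t.m, fun x i => star (t.m x i), fun x i => (t.l x i : ℂ), fun x i => (t.k x i : ℂ)]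

/-- The vector fields of the tetrad are smooth on `U`. -/
def Tetrad.SmoothOn (t : Tetrad) (U : Set Coord) : Prop :=
  ContDiffOn ℝ ∞ t.m U ∧ ContDiffOn ℝ ∞ t.l U ∧ ContDiffOn ℝ ∞ t.k U

/-- `t` is a smooth null tetrad on `U` for the smooth metric `g`. The last condition forces `g` to
be nondegenerate of Lorentzian signature `(-+++)` and the tetrad to be a basis at each point. -/
structure IsNullTetradOn (U : Set Coord) (g : Coord → Matrix (Fin 4) (Fin 4) ℝ) (t : Tetrad) :
    Prop where
  metric_smooth : ∀ i j, ContDiffOn ℝ ∞ (fun x => g x i j) U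
  metric_symm : ∀ x ∈ U, (g x).IsSymm
  tetrad_smooth : t.SmoothOn U
  inner_eq : ∀ x ∈ U, ∀ a b, metricInner g (t.e a) (t.e b) x = eta a b

/-- Tetrad components `R_{abcd}` of a field of (real) algebraic curvature tensors, smooth
on `U`. -/
structure IsCurvatureFieldOn (U : Set Coord) (Rm : Fin 4 → Fin 4 → Fin 4 → Fin 4 → Scalar) :
    Prop where
  smooth : ∀ a b c d, ContDiffOn ℝ ∞ (Rm a b c d) U
  antisymm_left : ∀ x ∈ U, ∀ a b c d, Rm a b c d x = -Rm b a c d x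
  antisymm_right : ∀ x ∈ U, ∀ a b c d, Rm a b c d x = -Rm a b d c x
  pair_symm : ∀ x ∈ U, ∀ a b c d, Rm a b c d x = Rm c d a b x
  cyclic : ∀ x ∈ U, ∀ a b c d, Rm a b c d x + Rm a c d b x + Rm a d b c x = 0
  real : ∀ x ∈ U, ∀ a b c d,
    star (Rm a b c d x) = Rm (conjIdx a) (conjIdx b) (conjIdx c) (conjIdx d) x

/-! ### The variables of the extended tetrad formalism -/

/-- The variables of the formalism: a tetrad, connection coefficients `Γ_{abc}` (last index:
direction of differentiation) and the tetrad components `R_{abcd}` of the Riemann tensor, which is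
an independent variable (equivalent to the Weyl scalars `Ψ`, the Ricci scalars `Φ` and `R`). -/
structure Fields where
  t : Tetrad
  Γ : Fin 4 → Fin 4 → Fin 4 → Scalar
  Rm : Fin 4 → Fin 4 → Fin 4 → Fin 4 → Scalar

/-- The fields belonging to a null tetrad of a metric `g` and a candidate Riemann tensor `Rm`:
`Γ_{abc} = e_a · ∇_{e_c} e_b` with the Levi-Civita connection `∇` of `g`. -/
def Fields.ofMetric (g : Coord → Matrix (Fin 4) (Fin 4) ℝ) (t : Tetrad)
    (Rm : Fin 4 → Fin 4 → Fin 4 → Fin 4 → Scalar) : Fields where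
  t := t
  Γ := fun a b c => metricInner g (t.e a) (covDeriv g (t.e c) (t.e b))
  Rm := Rm

namespace Fields

variable (F : Fields)

/-- The variables are smooth on `U`, the connection coefficients are those of a real connection for
which the tetrad metric is constant (`Γ_{(ab)c} = 0`), and `Rm` has the algebraic
symmetries of a Riemann tensor. -/
structure IsAdmissibleOn (U : Set Coord) : Prop where
  tetrad_smooth : F.t.SmoothOn U
  conn_smooth : ∀ a b c, ContDiffOn ℝ ∞ (F.Γ a b c) U
  conn_antisymm : ∀ x ∈ U, ∀ a b c, F.Γ a b c x = -F.Γ b a c x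
  conn_real : ∀ x ∈ U, ∀ a b c,
    star (F.Γ a b c x) = F.Γ (conjIdx a) (conjIdx b) (conjIdx c) x
  curv : IsCurvatureFieldOn U F.Rm

/-- The derivation `e_a` of scalars. -/
def d (a : Fin 4) (f : Scalar) : Scalar := dirDeriv (F.t.e a) f

/-- `Γ^a_{bc}`: `∇_{e_c} e_b = Γ^a_{bc} e_a`. -/
def Γup (a b c : Fin 4) : Scalar := fun x => ∑ f, eta a f * F.Γ f b c x

/-- The commutation coefficients `γ^c_{ab} = Γ^c_{ba} - Γ^c_{ab}` of a torsion-free connection. -/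
def comm (c a b : Fin 4) : Scalar := fun x => F.Γup c b a x - F.Γup c a b x

/-! ### Tensorial form of the equations -/

/-- The commutator relations `[e_a, e_b] = γ^c_{ab} e_c` at a point. -/
def CommutatorsAt (x : Coord) : Prop :=
  ∀ a b i, F.d a (fun y => F.t.e b y i) x - F.d b (fun y => F.t.e a y i) x
    = ∑ c, F.comm c a b x * F.t.e c x i

/-- The Jacobi equations `e_{[a} γ^d_{bc]} - γ^d_{e[a} γ^e_{bc]} = 0`. -/
def JacobiAt (x : Coord) : Prop :=
  ∀ a b c f,
    (F.d a (F.comm f b c) x - ∑ h, F.comm f h a x * F.comm h b c x)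
    + (F.d b (F.comm f c a) x - ∑ h, F.comm f h b x * F.comm h c a x)
    + (F.d c (F.comm f a b) x - ∑ h, F.comm f h c x * F.comm h a b x) = 0

/-- The right-hand side of the second Cartan equations, first index lowered:
`Γ_{abd,c} - Γ_{abc,d} + Γ^e_{bd} Γ_{aec} - Γ^e_{bc} Γ_{aed} - γ^e_{cd} Γ_{abe}`. -/
def cartan (a b c f : Fin 4) : Scalar := fun x =>
  F.d c (F.Γ a b f) x - F.d f (F.Γ a b c) x
    + ∑ h, (F.Γup h b f x * F.Γ a h c x - F.Γup h b c x * F.Γ a h f x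
        - F.comm h c f x * F.Γ a b h x)

/-- The second Cartan equations. -/
def CartanAt (x : Coord) : Prop :=
  ∀ a b c f, F.Rm a b c f x = F.cartan a b c f x

/-- Tetrad components `w^a_{;c}` of the covariant derivative of the vector `w^a e_a`. -/
def cov1 (w : Fin 4 → Scalar) (a c : Fin 4) : Scalar := fun x =>
  F.d c (w a) x + ∑ b, F.Γup a b c x * w b x

/-- Tetrad components `w^a_{;c;f}` of the second covariant derivative of `w^a e_a`. -/
def cov2 (w : Fin 4 → Scalar) (a c f : Fin 4) : Scalar := fun x =>
  F.d f (F.cov1 w a c) x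
    + ∑ b, (F.Γup a b f x * F.cov1 w b c x - F.Γup b c f x * F.cov1 w a b x)

/-- The tetrad components `k^a = δ^a_4` of `k`. -/
def kComp (a : Fin 4) : Scalar := fun _ => if a = 3 then 1 else 0

/-- The Ricci equations `k^a_{;c;d} - k^a_{;d;c} = R^a_{bdc} k^b` for `k`. -/
def RicciAt (x : Coord) : Prop :=
  ∀ a c f, F.cov2 kComp a c f x - F.cov2 kComp a f c x
    = ∑ b, (∑ h, eta a h * F.Rm h b f c x) * kComp b x

/-- Tetrad components `R_{abcf;h}` of the covariant derivative of the candidate Riemann tensor. -/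
def covRm (a b c f h : Fin 4) : Scalar := fun x =>
  F.d h (F.Rm a b c f) x
    - ∑ i, (F.Γup i a h x * F.Rm i b c f x + F.Γup i b h x * F.Rm a i c f x
        + F.Γup i c h x * F.Rm a b i f x + F.Γup i f h x * F.Rm a b c i x)

/-- The (second) Bianchi equations `R_{ab[cf;h]} = 0`. -/
def BianchiAt (x : Coord) : Prop :=
  ∀ a b c f h, F.covRm a b c f h x + F.covRm a b f h c x + F.covRm a b h c f x = 0

/-! ### Newman-Penrose variables

Indices: `0 = m`, `1 = m̄`, `2 = ℓ`, `3 = k`; e.g. `k_{a;b} m^a k^b = Γ_{144}` is `F.Γ 0 3 3`. -/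

/-- `D = k^a ∂_a`. -/
def D (f : Scalar) : Scalar := F.d 3 f

/-- `Δ = ℓ^a ∂_a`. -/
def Δ (f : Scalar) : Scalar := F.d 2 f

/-- `δ = m^a ∂_a`. -/
def δ (f : Scalar) : Scalar := F.d 0 f

/-- `δ̄ = m̄^a ∂_a`. -/
def δb (f : Scalar) : Scalar := F.d 1 f

/-- `κ = -k_{a;b} m^a k^b`. -/
def κ : Scalar := -F.Γ 0 3 3

/-- `ρ = -k_{a;b} m^a m̄^b`. -/
def ρ : Scalar := -F.Γ 0 3 1

/-- `σ = -k_{a;b} m^a m^b`. -/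
def σ : Scalar := -F.Γ 0 3 0

/-- `τ = -k_{a;b} m^a ℓ^b`. -/
def τ : Scalar := -F.Γ 0 3 2

/-- `ν = ℓ_{a;b} m̄^a ℓ^b`. -/
def ν : Scalar := F.Γ 1 2 2

/-- `μ = ℓ_{a;b} m̄^a m^b`. -/
def μ : Scalar := F.Γ 1 2 0

/-- `λ = ℓ_{a;b} m̄^a m̄^b`. -/
def lam : Scalar := F.Γ 1 2 1

/-- `π = ℓ_{a;b} m̄^a k^b`. -/
def π : Scalar := F.Γ 1 2 3

/-- `ε = -(1/2) (k_{a;b} ℓ^a k^b - m_{a;b} m̄^a k^b)`. -/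
def ε : Scalar := fun x => -(1 / 2) * (F.Γ 2 3 3 x - F.Γ 1 0 3 x)

/-- `β = -(1/2) (k_{a;b} ℓ^a m^b - m_{a;b} m̄^a m^b)`. -/
def β : Scalar := fun x => -(1 / 2) * (F.Γ 2 3 0 x - F.Γ 1 0 0 x)

/-- `γ = (1/2) (ℓ_{a;b} k^a ℓ^b - m̄_{a;b} m^a ℓ^b)`. -/
def γ : Scalar := fun x => (1 / 2) * (F.Γ 3 2 2 x - F.Γ 0 1 2 x)

/-- `α = (1/2) (ℓ_{a;b} k^a m̄^b - m̄_{a;b} m^a m̄^b)`. -/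
def α : Scalar := fun x => (1 / 2) * (F.Γ 3 2 1 x - F.Γ 0 1 1 x)

/-- The Ricci tensor `R_{bd} = R^c_{bcd}`. -/
def Ric (b f : Fin 4) : Scalar := fun x => ∑ c, ∑ h, eta c h * F.Rm h b c f x

/-- The curvature scalar. -/
def R : Scalar := fun x => ∑ b, ∑ f, eta b f * F.Ric b f x

/-- The Weyl tensor
`C_{abcd} = R_{abcd} - (g_{a[c} R_{d]b} + g_{b[d} R_{c]a}) + (1/3) R g_{a[c} g_{d]b}`. -/
def Weyl (a b c f : Fin 4) : Scalar := fun x =>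
  F.Rm a b c f x
    - (1 / 2) * (eta a c * F.Ric f b x - eta a f * F.Ric c b x
        + eta b f * F.Ric c a x - eta b c * F.Ric f a x)
    + (1 / 6) * F.R x * (eta a c * eta f b - eta a f * eta c b)

/-- `Ψ₀ = C_{abcd} k^a m^b k^c m^d`. -/
def Ψ0 : Scalar := F.Weyl 3 0 3 0

/-- `Ψ₁ = C_{abcd} k^a ℓ^b k^c m^d`. -/
def Ψ1 : Scalar := F.Weyl 3 2 3 0

/-- `Ψ₂ = C_{abcd} k^a m^b m̄^c ℓ^d`. -/
def Ψ2 : Scalar := F.Weyl 3 0 1 2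

/-- `Ψ₃ = C_{abcd} k^a ℓ^b m̄^c ℓ^d`. -/
def Ψ3 : Scalar := F.Weyl 3 2 1 2

/-- `Ψ₄ = C_{abcd} m̄^a ℓ^b m̄^c ℓ^d`. -/
def Ψ4 : Scalar := F.Weyl 1 2 1 2

/-- `Φ₀₀ = (1/2) R_{ab} k^a k^b`. -/
def Φ00 : Scalar := fun x => (1 / 2) * F.Ric 3 3 x

/-- `Φ₀₁ = (1/2) R_{ab} k^a m^b`. -/
def Φ01 : Scalar := fun x => (1 / 2) * F.Ric 3 0 x

/-- `Φ₁₀`, the conjugate of `Φ₀₁`. -/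
def Φ10 : Scalar := star F.Φ01

/-- `Φ₀₂ = (1/2) R_{ab} m^a m^b`. -/
def Φ02 : Scalar := fun x => (1 / 2) * F.Ric 0 0 x

/-- `Φ₂₀`, the conjugate of `Φ₀₂`. -/
def Φ20 : Scalar := star F.Φ02

/-- `Φ₁₁ = (1/4) R_{ab} (k^a ℓ^b + m^a m̄^b)`. -/
def Φ11 : Scalar := fun x => (1 / 4) * (F.Ric 3 2 x + F.Ric 0 1 x)

/-- `Φ₁₂ = (1/2) R_{ab} ℓ^a m^b`. -/
def Φ12 : Scalar := fun x => (1 / 2) * F.Ric 2 0 x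

/-- `Φ₂₁`, the conjugate of `Φ₁₂`. -/
def Φ21 : Scalar := star F.Φ12

/-- `Φ₂₂ = (1/2) R_{ab} ℓ^a ℓ^b`. -/
def Φ22 : Scalar := fun x => (1 / 2) * F.Ric 2 2 x

/-! ### The Newman-Penrose equations

`NPn` is the left-hand side minus the right-hand side of the `n`-th equation, which thus reads
`NPn = 0`. -/

def NP1 : Scalar :=
  F.D F.ρ - F.δb F.κ - (F.ρ ^ 2 + F.σ * star F.σ + (F.ε + star F.ε) * F.ρ - star F.κ * F.τ
    - F.κ * (3 * F.α + star F.β - F.π) + F.Φ00)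

def NP2 : Scalar :=
  F.D F.σ - F.δ F.κ - ((F.ρ + star F.ρ) * F.σ + (3 * F.ε - star F.ε) * F.σ
    - (F.τ - star F.π + star F.α + 3 * F.β) * F.κ + F.Ψ0)

def NP3 : Scalar :=
  F.D F.τ - F.Δ F.κ - ((F.τ + star F.π) * F.ρ + (star F.τ + F.π) * F.σ + (F.ε - star F.ε) * F.τ
    - (3 * F.γ + star F.γ) * F.κ + F.Ψ1 + F.Φ01)

def NP4 : Scalar :=
  F.D F.α - F.δb F.ε - ((F.ρ + star F.ε - 2 * F.ε) * F.α + F.β * star F.σ - star F.β * F.ε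
    - F.κ * F.lam - star F.κ * F.γ + (F.ε + F.ρ) * F.π + F.Φ10)

def NP5 : Scalar :=
  F.D F.β - F.δ F.ε - ((F.α + F.π) * F.σ + (star F.ρ - star F.ε) * F.β - (F.μ + F.γ) * F.κ
    - (star F.α - star F.π) * F.ε + F.Ψ1)

def NP6 : Scalar :=
  F.D F.γ - F.Δ F.ε - ((F.τ + star F.π) * F.α + (star F.τ + F.π) * F.β - (F.ε + star F.ε) * F.γ
    - (F.γ + star F.γ) * F.ε + F.τ * F.π - F.ν * F.κ + F.Ψ2 + F.Φ11 - F.R / 24)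

def NP7 : Scalar :=
  F.D F.lam - F.δb F.π - (F.ρ * F.lam + star F.σ * F.μ + F.π ^ 2 + (F.α - star F.β) * F.π
    - F.ν * star F.κ - (3 * F.ε - star F.ε) * F.lam + F.Φ20)

def NP8 : Scalar :=
  F.D F.μ - F.δ F.π - (star F.ρ * F.μ + F.σ * F.lam + F.π * star F.π - (F.ε + star F.ε) * F.μ
    - F.π * (star F.α - F.β) - F.κ * F.ν + F.Ψ2 + F.R / 12)

def NP9 : Scalar :=
  F.D F.ν - F.Δ F.π - ((F.π + star F.τ) * F.μ + (star F.π + F.τ) * F.lam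
    + (F.γ - star F.γ) * F.π - (3 * F.ε + star F.ε) * F.ν + F.Ψ3 + F.Φ21)

def NP10 : Scalar :=
  F.Δ F.lam - F.δb F.ν - (-(F.μ + star F.μ) * F.lam - (3 * F.γ - star F.γ) * F.lam
    + (3 * F.α + star F.β + F.π - star F.τ) * F.ν - F.Ψ4)

def NP11 : Scalar :=
  F.δ F.ρ - F.δb F.σ - (F.ρ * (star F.α + F.β) - F.σ * (3 * F.α - star F.β)
    + (F.ρ - star F.ρ) * F.τ + (F.μ - star F.μ) * F.κ - F.Ψ1 + F.Φ01)

def NP12 : Scalar :=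
  F.δ F.α - F.δb F.β - (F.μ * F.ρ - F.lam * F.σ + F.α * star F.α + F.β * star F.β
    - 2 * F.α * F.β + F.γ * (F.ρ - star F.ρ) + F.ε * (F.μ - star F.μ) - F.Ψ2 + F.Φ11 + F.R / 24)

def NP13 : Scalar :=
  F.δ F.lam - F.δb F.μ - ((F.ρ - star F.ρ) * F.ν + (F.μ - star F.μ) * F.π
    + F.μ * (F.α + star F.β) + F.lam * (star F.α - 3 * F.β) - F.Ψ3 + F.Φ21)

def NP14 : Scalar :=
  F.δ F.ν - F.Δ F.μ - (F.μ ^ 2 + F.lam * star F.lam + (F.γ + star F.γ) * F.μ - star F.ν * F.π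
    + (F.τ - 3 * F.β - star F.α) * F.ν + F.Φ22)

def NP15 : Scalar :=
  F.δ F.γ - F.Δ F.β - ((F.τ - star F.α - F.β) * F.γ + F.μ * F.τ - F.σ * F.ν - F.ε * star F.ν
    - F.β * (F.γ - star F.γ - F.μ) + F.α * star F.lam + F.Φ12)

def NP16 : Scalar :=
  F.δ F.τ - F.Δ F.σ - (F.μ * F.σ + star F.lam * F.ρ + (F.τ + F.β - star F.α) * F.τ
    - (3 * F.γ - star F.γ) * F.σ - F.κ * star F.ν + F.Φ02)

def NP17 : Scalar :=
  F.Δ F.ρ - F.δb F.τ - (-(F.ρ * star F.μ + F.σ * F.lam) + (star F.β - F.α - star F.τ) * F.τ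
    + (F.γ + star F.γ) * F.ρ + F.ν * F.κ - F.Ψ2 - F.R / 12)

def NP18 : Scalar :=
  F.Δ F.α - F.δb F.γ - ((F.ρ + F.ε) * F.ν - (F.τ + F.β) * F.lam + (star F.γ - star F.μ) * F.α
    + (star F.β - star F.τ) * F.γ - F.Ψ3)

/-- All eighteen Newman-Penrose equations hold at `x`. -/
def AllNPAt (x : Coord) : Prop :=
  F.NP1 x = 0 ∧ F.NP2 x = 0 ∧ F.NP3 x = 0 ∧ F.NP4 x = 0 ∧ F.NP5 x = 0 ∧ F.NP6 x = 0 ∧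
  F.NP7 x = 0 ∧ F.NP8 x = 0 ∧ F.NP9 x = 0 ∧ F.NP10 x = 0 ∧ F.NP11 x = 0 ∧ F.NP12 x = 0 ∧
  F.NP13 x = 0 ∧ F.NP14 x = 0 ∧ F.NP15 x = 0 ∧ F.NP16 x = 0 ∧ F.NP17 x = 0 ∧ F.NP18 x = 0

/-- The Jacobi part of the Newman-Penrose equations. -/
def JacobiNPAt (x : Coord) : Prop :=
  (star F.NP1 - F.NP1) x = 0 ∧
  (star F.NP14 - F.NP14) x = 0 ∧
  (star F.NP12 + star F.NP8 - F.NP12 - F.NP8) x = 0 ∧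
  (star F.NP6 - F.NP6 + F.NP8 - star F.NP8) x = 0 ∧
  (F.NP16 - star F.NP7) x = 0 ∧
  (F.NP17 + F.NP8) x = 0 ∧
  (2 * F.NP4 - star F.NP3 - star F.NP11) x = 0 ∧
  (2 * F.NP5 - F.NP3 + F.NP11) x = 0 ∧
  (2 * F.NP15 - star F.NP9 - star F.NP13) x = 0 ∧
  (2 * F.NP18 + F.NP9 - F.NP13) x = 0

/-- The part of the Newman-Penrose equations given by the Ricci equations for `k`. -/
def RicciNPAt (x : Coord) : Prop :=
  F.NP1 x = 0 ∧ F.NP2 x = 0 ∧ F.NP3 x = 0 ∧ F.NP11 x = 0 ∧ F.NP16 x = 0 ∧ F.NP17 x = 0 ∧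
  (star F.NP4 + F.NP5) x = 0 ∧
  (F.NP15 - star F.NP18) x = 0 ∧
  (star F.NP6 + F.NP6) x = 0 ∧
  (star F.NP12 - F.NP12) x = 0

/-- The field equations not contained in the Jacobi and Ricci parts. -/
def FieldNPAt (x : Coord) : Prop :=
  F.NP10 x = 0 ∧ F.NP13 x = 0 ∧ (F.NP12 + star F.NP12) x = 0 ∧ (F.NP14 + star F.NP14) x = 0

end Fields

end NewmanPenrose

end

noncomputable section

namespace NewmanPenrose

open Filter Topology

/-! ### Directional derivatives -/

section DirDeriv

variable {v : VecField} {f g : Scalar} {x : Coord}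

/-! Everything is expressed through one tensor, `defect`: the candidate Riemann tensor minus the
curvature expression formed from the connection coefficients. It is real and antisymmetric in each
index pair, and `np_eq_defect` identifies every Newman–Penrose expression with a combination of its
components. The second Cartan equations say that the defect vanishes. Since the candidate satisfies
the cyclic identity, the Jacobi equations say that the cyclic sum of the defect over its last three
slots vanishes (`jacobiAt_iff_defect`). The Ricci equations for `k` say that `k` annihilates its
second slot (`ricciAt_iff_defect`). The equivalences with the Newman–Penrose systems are then finite
linear algebra with conjugates.

For the integrability statement, commutators and Jacobi equations give the differential Bianchi
identity for the connection's curvature (`bianchi_cartan`), so the defect satisfies the Bianchi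
equations too. Jacobi and Ricci together make `k` annihilate every slot (`defect_last_eq_zero`).
Contracting a Bianchi equation with `k` shows that if `X` annihilates the first slot, so does `∇_k
X` (`sum_cov1_mul_eq_zero`). Hence `k`, `∇_k k` and `∇_k ∇_k k` all annihilate it. If `κ ≠ 0` these
three are linearly independent, leaving a single free value of the first index, and antisymmetry
kills the defect. The metric enters only by supplying an admissible connection that obeys the
commutator relations.

Algebraic independence is shown by an explicit model with zero candidate tensor and spin
coefficients affine in the coordinates. At the origin only `κ` survives, so each Newman–Penrose
expression reduces to derivatives that can be prescribed. -/

theorem dirDeriv_congr (h : f =ᶠ[𝓝 x] g) : dirDeriv v f x = dirDeriv v g x := by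
  simp only [dirDeriv, h.fderiv_eq]

theorem dirDeriv_congr_of_isOpen {U : Set Coord} (hU : IsOpen U) (hx : x ∈ U)
    (h : ∀ y ∈ U, f y = g y) : dirDeriv v f x = dirDeriv v g x :=
  dirDeriv_congr (Filter.eventually_of_mem (hU.mem_nhds hx) h)

theorem dirDeriv_star (v : VecField) (f : Scalar) (x : Coord) :
    star (dirDeriv v f x) = dirDeriv (fun y i => star (v y i)) (fun y => star (f y)) x := by
  simp only [dirDeriv, star_sum, star_mul', fderiv_star]
  rfl

@[simp] theorem dirDeriv_const (v : VecField) (c : ℂ) (x : Coord) :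
    dirDeriv v (fun _ => c) x = 0 := by
  simp [dirDeriv]

theorem dirDeriv_neg (v : VecField) (f : Scalar) (x : Coord) :
    dirDeriv v (fun y => -f y) x = -dirDeriv v f x := by
  simp only [dirDeriv, fderiv_fun_neg, _root_.neg_apply, mul_neg,
    Finset.sum_neg_distrib]

theorem dirDeriv_add (hf : DifferentiableAt ℝ f x) (hg : DifferentiableAt ℝ g x) :
    dirDeriv v (fun y => f y + g y) x = dirDeriv v f x + dirDeriv v g x := by
  simp only [dirDeriv, fderiv_fun_add hf hg, _root_.add_apply, mul_add,
    Finset.sum_add_distrib]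

theorem dirDeriv_sub (hf : DifferentiableAt ℝ f x) (hg : DifferentiableAt ℝ g x) :
    dirDeriv v (fun y => f y - g y) x = dirDeriv v f x - dirDeriv v g x := by
  simp only [dirDeriv, fderiv_fun_sub hf hg, _root_.sub_apply, mul_sub,
    Finset.sum_sub_distrib]

theorem dirDeriv_mul (hf : DifferentiableAt ℝ f x) (hg : DifferentiableAt ℝ g x) :
    dirDeriv v (fun y => f y * g y) x = dirDeriv v f x * g x + f x * dirDeriv v g x := by
  simp only [dirDeriv, fderiv_fun_mul hf hg, _root_.add_apply,
    _root_.smul_apply, smul_eq_mul, Finset.sum_mul, Finset.mul_sum,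
    ← Finset.sum_add_distrib]
  exact Finset.sum_congr rfl fun _ _ => by ring

theorem dirDeriv_const_mul (c : ℂ) (hf : DifferentiableAt ℝ f x) :
    dirDeriv v (fun y => c * f y) x = c * dirDeriv v f x := by
  simp [dirDeriv_mul (differentiableAt_const c) hf]

theorem dirDeriv_sum {ι : Type*} {s : Finset ι} {f : ι → Scalar}
    (hf : ∀ i ∈ s, DifferentiableAt ℝ (f i) x) :
    dirDeriv v (fun y => ∑ i ∈ s, f i y) x = ∑ i ∈ s, dirDeriv v (f i) x := by
  simp only [dirDeriv, fderiv_fun_sum hf, _root_.sum_apply, Finset.mul_sum]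
  exact Finset.sum_comm

end DirDeriv

/-! ### Index gymnastics -/

@[simp] theorem conjIdx_zero : conjIdx 0 = 1 := rfl
@[simp] theorem conjIdx_one : conjIdx 1 = 0 := rfl
@[simp] theorem conjIdx_two : conjIdx 2 = 2 := rfl
@[simp] theorem conjIdx_three : conjIdx 3 = 3 := rfl

/-- Raising an index with the tetrad metric. -/
theorem eta_sum (f : Fin 4 → ℂ) (a : Fin 4) :
    ∑ h, eta a h * f h = ![f 1, f 0, -f 3, -f 2] a := by
  fin_cases a <;> simp [eta, Fin.sum_univ_four]

theorem eq_zero_of_antisymm {A : Fin 4 → Fin 4 → ℂ} (h : ∀ a b, A a b = -A b a)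
    (h01 : A 0 1 = 0) (h02 : A 0 2 = 0) (h03 : A 0 3 = 0) (h12 : A 1 2 = 0) (h13 : A 1 3 = 0)
    (h23 : A 2 3 = 0) (a b : Fin 4) : A a b = 0 := by
  have hd : ∀ a, A a a = 0 := fun a => by linear_combination (1 / 2) * h a a
  fin_cases a <;> fin_cases b <;>
    first | exact hd _ | assumption | exact (h _ _).trans (neg_eq_zero.mpr ‹_›)

/-- Cyclic invariance together with antisymmetry in the first two slots is total antisymmetry, so in
dimension four only four components are independent. -/
theorem eq_zero_of_cyclic {T : Fin 4 → Fin 4 → Fin 4 → ℂ} (h : ∀ a b c, T a b c = T b c a)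
    (h' : ∀ a b c, T a b c = -T b a c) (h012 : T 0 1 2 = 0) (h013 : T 0 1 3 = 0)
    (h023 : T 0 2 3 = 0) (h123 : T 1 2 3 = 0) (a b c : Fin 4) : T a b c = 0 := by
  have hd : ∀ a b, T a a b = 0 := fun a b => by linear_combination (1 / 2) * h' a a b
  have hd' : ∀ a b, T a b b = 0 := fun a b => by rw [h, hd]
  have hd'' : ∀ a b, T b a b = 0 := fun a b => by rw [h, hd']
  have key : ∀ a b c, T a b c = 0 → T b c a = 0 ∧ T c a b = 0 ∧ T b a c = 0 ∧ T a c b = 0 ∧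
      T c b a = 0 := fun a b c h0 => by
    have h1 : T b c a = 0 := by rw [← h, h0]
    have h2 : T c a b = 0 := by rw [← h, h1]
    refine ⟨h1, h2, ?_, ?_, ?_⟩
    · rw [h', h0, neg_zero]
    · rw [h', h2, neg_zero]
    · rw [h', h1, neg_zero]
  obtain ⟨_, _, _, _, _⟩ := key _ _ _ h012
  obtain ⟨_, _, _, _, _⟩ := key _ _ _ h013
  obtain ⟨_, _, _, _, _⟩ := key _ _ _ h023
  obtain ⟨_, _, _, _, _⟩ := key _ _ _ h123
  fin_cases a <;> fin_cases b <;> fin_cases c <;>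
    first | exact hd _ _ | exact hd' _ _ | exact hd'' _ _ | assumption

/-! ### The defect and its Newman–Penrose components -/

namespace Fields

variable {F : Fields} {U : Set Coord} {x : Coord}

theorem star_e (t : Tetrad) (a : Fin 4) :
    (fun (y : Coord) i => star (t.e a y i)) = t.e (conjIdx a) := by
  fin_cases a <;> funext y i <;> simp [Tetrad.e]

theorem star_d (F : Fields) (a : Fin 4) (f : Scalar) (x : Coord) :
    star (F.d a f x) = F.d (conjIdx a) (fun y => star (f y)) x := by
  simp only [d, dirDeriv_star, star_e]

theorem Γup_zero (F : Fields) (b c : Fin 4) : F.Γup 0 b c = fun x => F.Γ 1 b c x := by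
  funext x; simp [Γup, eta_sum]
theorem Γup_one (F : Fields) (b c : Fin 4) : F.Γup 1 b c = fun x => F.Γ 0 b c x := by
  funext x; simp [Γup, eta_sum]
theorem Γup_two (F : Fields) (b c : Fin 4) : F.Γup 2 b c = fun x => -F.Γ 3 b c x := by
  funext x; simp [Γup, eta_sum]
theorem Γup_three (F : Fields) (b c : Fin 4) : F.Γup 3 b c = fun x => -F.Γ 2 b c x := by
  funext x; simp [Γup, eta_sum]

/-- The difference of the two sides of the second Cartan equations. -/
def defect (F : Fields) (a b c f : Fin 4) : Scalar := fun x => F.Rm a b c f x - F.cartan a b c f x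

theorem cartanAt_iff_defect : F.CartanAt x ↔ ∀ a b c f, F.defect a b c f x = 0 := by
  simp only [CartanAt, defect, sub_eq_zero]

theorem cartan_antisymm_right (F : Fields) (a b c f : Fin 4) (x : Coord) :
    F.cartan a b c f x = -F.cartan a b f c x := by
  simp only [cartan, comm, Fin.sum_univ_four]
  ring

namespace IsAdmissibleOn

variable (hF : F.IsAdmissibleOn U)
include hF

theorem conn_differentiableAt (hU : IsOpen U) (hx : x ∈ U) (a b c : Fin 4) :
    DifferentiableAt ℝ (F.Γ a b c) x :=
  ((hF.conn_smooth a b c).contDiffAt (hU.mem_nhds hx)).differentiableAt (by simp)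

theorem d_conn_antisymm (hU : IsOpen U) (hx : x ∈ U) (h a b c : Fin 4) :
    F.d h (F.Γ a b c) x = -F.d h (F.Γ b a c) x := by
  simp only [d]
  rw [← dirDeriv_neg]
  exact dirDeriv_congr_of_isOpen hU hx fun y hy => hF.conn_antisymm y hy a b c

theorem star_d_conn (hU : IsOpen U) (hx : x ∈ U) (h a b c : Fin 4) :
    star (F.d h (F.Γ a b c) x) =
      F.d (conjIdx h) (F.Γ (conjIdx a) (conjIdx b) (conjIdx c)) x := by
  rw [star_d]
  exact dirDeriv_congr_of_isOpen hU hx fun y hy => hF.conn_real y hy a b c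

theorem star_Γup (hx : x ∈ U) (a b c : Fin 4) :
    star (F.Γup a b c x) = F.Γup (conjIdx a) (conjIdx b) (conjIdx c) x := by
  have h := hF.conn_real x hx
  fin_cases a <;> simp [Γup_zero, Γup_one, Γup_two, Γup_three] <;> exact h _ _ _

theorem star_comm (hx : x ∈ U) (a b c : Fin 4) :
    star (F.comm a b c x) = F.comm (conjIdx a) (conjIdx b) (conjIdx c) x := by
  simp only [comm, star_sub, hF.star_Γup hx]

theorem star_cartan (hU : IsOpen U) (hx : x ∈ U) (a b c f : Fin 4) :
    star (F.cartan a b c f x)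
      = F.cartan (conjIdx a) (conjIdx b) (conjIdx c) (conjIdx f) x := by
  simp only [cartan, star_add, star_sub, star_mul', hF.star_d_conn hU hx,
    hF.star_Γup hx, hF.star_comm hx, hF.conn_real x hx, Fin.sum_univ_four, conjIdx_zero,
    conjIdx_one, conjIdx_two, conjIdx_three]
  ring

theorem star_defect (hU : IsOpen U) (hx : x ∈ U) (a b c f : Fin 4) :
    star (F.defect a b c f x)
      = F.defect (conjIdx a) (conjIdx b) (conjIdx c) (conjIdx f) x := by
  simp only [defect, star_sub, hF.star_cartan hU hx, hF.curv.real x hx]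

/-- A connection preserving the tetrad metric is antisymmetric in its first two indices. The
derivative terms inherit this, and exchanging `a` and `b` interchanges the two quadratic terms,
which have opposite signs. -/
theorem cartan_antisymm_left (hU : IsOpen U) (hx : x ∈ U) (a b c f : Fin 4) :
    F.cartan a b c f x = -F.cartan b a c f x := by
  have h := hF.conn_antisymm x hx
  simp only [cartan, Fin.sum_univ_four, Γup_zero, Γup_one, Γup_two, Γup_three]
  rw [hF.d_conn_antisymm hU hx c a b f, hF.d_conn_antisymm hU hx f a b c, h a b 0, h a b 1, h a b 2,
    h a b 3, h 0 b f, h 0 b c, h 1 b f, h 1 b c, h 2 b f, h 2 b c, h 3 b f, h 3 b c,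
    h a 0 f, h a 0 c, h a 1 f, h a 1 c, h a 2 f, h a 2 c, h a 3 f, h a 3 c]
  ring

theorem defect_antisymm_left (hU : IsOpen U) (hx : x ∈ U) (a b c f : Fin 4) :
    F.defect a b c f x = -F.defect b a c f x := by
  simp only [defect]
  rw [hF.cartan_antisymm_left hU hx, hF.curv.antisymm_left x hx]
  ring

theorem defect_antisymm_right (hx : x ∈ U) (a b c f : Fin 4) :
    F.defect a b c f x = -F.defect a b f c x := by
  simp only [defect]
  rw [F.cartan_antisymm_right, hF.curv.antisymm_right x hx]
  ring

/-- The derivatives of the spin coefficients in terms of those of the connection coefficients. -/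
theorem d_spin (hU : IsOpen U) (hx : x ∈ U) (h : Fin 4) :
    F.d h F.ε x = -(1 / 2) * (F.d h (F.Γ 2 3 3) x - F.d h (F.Γ 1 0 3) x) ∧
    F.d h F.β x = -(1 / 2) * (F.d h (F.Γ 2 3 0) x - F.d h (F.Γ 1 0 0) x) ∧
    F.d h F.γ x = (1 / 2) * (F.d h (F.Γ 3 2 2) x - F.d h (F.Γ 0 1 2) x) ∧
    F.d h F.α x = (1 / 2) * (F.d h (F.Γ 3 2 1) x - F.d h (F.Γ 0 1 1) x) := by
  have hd := hF.conn_differentiableAt hU hx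
  have hs : ∀ a b c a' b' c', DifferentiableAt ℝ (fun y => F.Γ a b c y - F.Γ a' b' c' y) x :=
    fun a b c a' b' c' => (hd a b c).sub (hd a' b' c')
  refine ⟨?_, ?_, ?_, ?_⟩
  · exact (dirDeriv_const_mul _ (hs _ _ _ _ _ _)).trans
      (by rw [dirDeriv_sub (hd _ _ _) (hd _ _ _)]; rfl)
  · exact (dirDeriv_const_mul _ (hs _ _ _ _ _ _)).trans
      (by rw [dirDeriv_sub (hd _ _ _) (hd _ _ _)]; rfl)
  · exact (dirDeriv_const_mul _ (hs _ _ _ _ _ _)).trans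
      (by rw [dirDeriv_sub (hd _ _ _) (hd _ _ _)]; rfl)
  · exact (dirDeriv_const_mul _ (hs _ _ _ _ _ _)).trans
      (by rw [dirDeriv_sub (hd _ _ _) (hd _ _ _)]; rfl)

set_option maxHeartbeats 4000000 in
/-- Each Newman-Penrose equation is a combination of the second Cartan equations. -/
theorem np_eq_defect (hU : IsOpen U) (hx : x ∈ U) :
    F.NP1 x = F.defect 0 3 3 1 x ∧
    F.NP2 x = F.defect 0 3 3 0 x ∧
    F.NP3 x = F.defect 0 3 3 2 x ∧
    F.NP4 x = (1 / 2) * (F.defect 0 1 3 1 x - F.defect 3 2 3 1 x) ∧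
    F.NP5 x = (1 / 2) * (F.defect 0 1 3 0 x - F.defect 3 2 3 0 x) ∧
    F.NP6 x = (1 / 2) * (F.defect 0 1 3 2 x - F.defect 3 2 3 2 x) ∧
    F.NP7 x = -F.defect 1 2 3 1 x ∧
    F.NP8 x = -F.defect 1 2 3 0 x ∧
    F.NP9 x = -F.defect 1 2 3 2 x ∧
    F.NP10 x = -F.defect 1 2 2 1 x ∧
    F.NP11 x = F.defect 0 3 0 1 x ∧
    F.NP12 x = (1 / 2) * (F.defect 0 1 0 1 x - F.defect 3 2 0 1 x) ∧
    F.NP13 x = -F.defect 1 2 0 1 x ∧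
    F.NP14 x = -F.defect 1 2 0 2 x ∧
    F.NP15 x = (1 / 2) * (F.defect 0 1 0 2 x - F.defect 3 2 0 2 x) ∧
    F.NP16 x = F.defect 0 3 0 2 x ∧
    F.NP17 x = F.defect 0 3 2 1 x ∧
    F.NP18 x = (1 / 2) * (F.defect 0 1 2 1 x - F.defect 3 2 2 1 x) := by
  have g := hF.conn_antisymm x hx
  have gd : ∀ a c, F.Γ a a c x = 0 := fun a c => by linear_combination (1 / 2) * g a a c
  have dg := hF.d_conn_antisymm hU hx
  have hε := fun h => (hF.d_spin hU hx h).1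
  have hβ := fun h => (hF.d_spin hU hx h).2.1
  have hγ := fun h => (hF.d_spin hU hx h).2.2.1
  have hα := fun h => (hF.d_spin hU hx h).2.2.2
  have hneg : ∀ h a b c, F.d h (-F.Γ a b c) x = -F.d h (F.Γ a b c) x := fun h a b c =>
    dirDeriv_neg _ _ _
  have hr := hF.conn_real x hx
  have r := hF.curv.antisymm_left x hx
  have rd : ∀ a b c, F.Rm a a b c x = 0 := fun a b c => by linear_combination (1 / 2) * r a a b c
  have r' := hF.curv.antisymm_right x hx
  have rd' : ∀ a b c, F.Rm b c a a x = 0 := fun a b c => by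
    linear_combination (1 / 2) * r' b c a a
  have rp := hF.curv.pair_symm x hx
  -- The only case of the cyclic identity independent of the pair symmetries; it eliminates one
  -- curvature component.
  have rc : F.Rm 0 1 2 3 x = F.Rm 0 2 1 3 x - F.Rm 0 3 1 2 x := by
    linear_combination hF.curv.cyclic x hx 0 1 2 3 - r' 0 2 3 1
  have rr := hF.curv.real x hx
  have h2 : star (2 : ℂ) = 2 := star_ofNat 2
  refine ⟨?_, ?_, ?_, ?_, ?_, ?_, ?_, ?_, ?_, ?_, ?_, ?_, ?_, ?_, ?_, ?_, ?_, ?_⟩ <;>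
  · simp only [NP1, NP2, NP3, NP4, NP5, NP6, NP7, NP8, NP9, NP10, NP11, NP12, NP13, NP14, NP15,
      NP16, NP17, NP18, D, Δ, δ, δb, Pi.sub_apply, Pi.add_apply, Pi.mul_apply, Pi.neg_apply,
      Pi.pow_apply, Pi.div_apply, Pi.star_apply, Pi.ofNat_apply, hε, hβ, hγ, hα]
    simp only [κ, ρ, σ, τ, ν, μ, lam, π, ε, β, γ, α, Ψ0, Ψ1, Ψ2, Ψ3, Ψ4, Φ00, Φ01, Φ10, Φ02, Φ20,
      Φ11, Φ12, Φ21, Φ22, Weyl, R, Ric, Pi.neg_apply, Pi.star_apply, hneg, star_neg, star_mul',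
      star_sub, star_add, star_div₀, star_one, h2, hr, rr, conjIdx_zero, conjIdx_one,
      conjIdx_two, conjIdx_three, defect, cartan, comm, Γup_zero, Γup_one, Γup_two, Γup_three,
      Fin.sum_univ_four]
    -- Normal form: index pairs are put in increasing order and the two pairs of `Rm` are ordered by
    -- symmetry. Conjugates have already become index swaps, so what remains is a polynomial
    -- identity.
    simp [eta, rd, rd', gd, g 1 0, g 2 0, g 3 0, g 2 1, g 3 1, g 3 2, dg _ 1 0,
      dg _ 3 2, r 1 0, r 2 0, r 3 0, r 2 1, r 3 1, r 3 2, r' _ _ 1 0, r' _ _ 2 0, r' _ _ 3 0, r' _ _ 2 1, r' _ _ 3 1, r' _ _ 3 2,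
      rp 0 2 0 1, rp 0 3 0 1, rp 1 2 0 1, rp 1 3 0 1, rp 2 3 0 1, rp 0 3 0 2, rp 1 2 0 2,
      rp 1 3 0 2, rp 2 3 0 2, rp 1 2 0 3, rp 1 3 0 3, rp 2 3 0 3, rp 1 3 1 2, rp 2 3 1 2,
      rp 2 3 1 3, rc]
    ring

end IsAdmissibleOn

/-! ### Jacobi, Ricci and second Cartan equations as linear conditions on the defect -/

theorem raise_eq_zero_iff {f : Fin 4 → ℂ} : (∀ a, ∑ h, eta a h * f h = 0) ↔ ∀ a, f a = 0 := by
  simp only [eta_sum]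
  constructor
  · intro h a
    have h0 := h 0
    have h1 := h 1
    have h2 := h 2
    have h3 := h 3
    simp at h0 h1 h2 h3
    fin_cases a <;> assumption
  · intro h a
    fin_cases a <;> simp [h]

/-- The second Cartan expression with its first index raised. -/
theorem raise_cartan (F : Fields) (x : Coord) (i a b c : Fin 4) :
    ∑ h, eta i h * F.cartan h a b c x = F.d b (F.Γup i a c) x - F.d c (F.Γup i a b) x
      + ∑ h, (F.Γup h a c x * F.Γup i h b x - F.Γup h a b x * F.Γup i h c x
        - F.comm h b c x * F.Γup i a h x) := by
  have hneg : ∀ h a b c, F.d h (fun y => -F.Γ a b c y) x = -F.d h (F.Γ a b c) x :=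
    fun h a b c => dirDeriv_neg _ _ _
  rw [eta_sum]
  fin_cases i <;>
  · simp only [cartan, Γup_zero, Γup_one, Γup_two, Γup_three, hneg, Fin.sum_univ_four,
      Fin.zero_eta, Fin.mk_one, Fin.reduceFinMk, Matrix.cons_val]
    try ring

theorem d_comm (hF : F.IsAdmissibleOn U) (hU : IsOpen U) (hx : x ∈ U) (h i a b : Fin 4) :
    F.d h (F.comm i a b) x = F.d h (F.Γup i b a) x - F.d h (F.Γup i a b) x := by
  have hd : ∀ i a b, DifferentiableAt ℝ (F.Γup i a b) x := fun i a b =>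
    DifferentiableAt.fun_sum fun h _ =>
      (differentiableAt_const _).mul (hF.conn_differentiableAt hU hx h a b)
  exact dirDeriv_sub (hd _ _ _) (hd _ _ _)

theorem cov1_kComp (F : Fields) (a c : Fin 4) : F.cov1 kComp a c = F.Γup a 3 c := by
  funext y
  have : F.d c (kComp a) y = 0 := dirDeriv_const _ _ _
  simp [cov1, this, kComp]

/-- Because `k` has constant tetrad components, `∇k` is the column `Γup a 3 c` of the connection,
and the commutator of second derivatives is the curvature expression with second index `3`. The
defect with that index is what separates the two sides. -/
theorem ricciAt_iff_defect : F.RicciAt x ↔ ∀ a c f, F.defect a 3 c f x = 0 := by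
  have key : ∀ a c f, F.cov2 kComp a c f x - F.cov2 kComp a f c x
      - ∑ b, (∑ h, eta a h * F.Rm h b f c x) * kComp b x
      = -∑ h, eta a h * F.defect h 3 f c x := by
    intro a c f
    have h2 : ∑ b, (∑ h, eta a h * F.Rm h b f c x) * kComp b x
        = ∑ h, eta a h * F.Rm h 3 f c x := by
      simp [kComp]
    rw [h2]
    simp only [defect, mul_sub, Finset.sum_sub_distrib, raise_cartan, cov2, cov1_kComp]
    simp only [comm, Fin.sum_univ_four]
    ring
  constructor
  · intro h a c f
    refine (raise_eq_zero_iff (f := fun a => F.defect a 3 c f x)).mp (fun a => ?_) a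
    rw [← neg_eq_zero, ← key, h a f c, sub_self]
  · intro h a c f
    rw [← sub_eq_zero, key]
    simp [h]

namespace IsAdmissibleOn

variable (hF : F.IsAdmissibleOn U)
include hF

/-- This is the first Bianchi identity: for coefficients built from a torsion-free connection, the
Jacobi expression is the cyclic sum of the curvature with one index raised. The candidate tensor
contributes nothing to the cyclic sum. -/
theorem jacobiAt_iff_defect (hU : IsOpen U) (hx : x ∈ U) :
    F.JacobiAt x ↔ ∀ h a b c,
      F.defect h a b c x + F.defect h b c a x + F.defect h c a b x = 0 := by
  have key : ∀ a b c i,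
      (F.d a (F.comm i b c) x - ∑ h, F.comm i h a x * F.comm h b c x)
      + (F.d b (F.comm i c a) x - ∑ h, F.comm i h b x * F.comm h c a x)
      + (F.d c (F.comm i a b) x - ∑ h, F.comm i h c x * F.comm h a b x)
      = -∑ h, eta i h * (F.defect h a b c x + F.defect h b c a x + F.defect h c a b x) := by
    intro a b c i
    have hT : ∀ h, F.defect h a b c x + F.defect h b c a x + F.defect h c a b x
        = -(F.cartan h a b c x + F.cartan h b c a x + F.cartan h c a b x) := fun h => by
      simp only [defect]
      linear_combination hF.curv.cyclic x hx h a b c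
    simp only [hT, mul_neg, Finset.sum_neg_distrib, neg_neg, mul_add, Finset.sum_add_distrib,
      raise_cartan, d_comm hF hU hx]
    simp only [comm, Fin.sum_univ_four]
    ring
  simp only [JacobiAt, key, neg_eq_zero]
  constructor
  · intro h i a b c
    exact raise_eq_zero_iff.mp (fun i => h a b c i) i
  · intro h a b c i
    exact raise_eq_zero_iff.mpr (fun i => h i a b c) i

/-- Regard the defect as a matrix indexed by pairs. Rows `03` and `12` occur in full, and
conjugation supplies rows `13` and `02`. The other six expressions contain the difference of rows
`01` and `32`; conjugation reverses `01` but fixes `32`, so the conjugate equations contain their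
sum. Thus eighteen complex equations determine all thirty-six components. -/
theorem cartanAt_iff_allNPAt (hU : IsOpen U) (hx : x ∈ U) : F.CartanAt x ↔ F.AllNPAt x := by
  have l := hF.defect_antisymm_left hU hx
  have r := hF.defect_antisymm_right hx
  have s := hF.star_defect hU hx
  rw [cartanAt_iff_defect]
  obtain ⟨n1, n2, n3, n4, n5, n6, n7, n8, n9, n10, n11, n12, n13, n14, n15, n16, n17, n18⟩ :=
    hF.np_eq_defect hU hx
  simp only [AllNPAt, n1, n2, n3, n4, n5, n6, n7, n8, n9, n10, n11, n12, n13, n14, n15, n16, n17,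
    n18]
  refine ⟨fun h => by simp [h], ?_⟩
  rintro ⟨h1, h2, h3, h4, h5, h6, h7, h8, h9, h10, h11, h12, h13, h14, h15, h16, h17, h18⟩
  have cj : ∀ {z : ℂ}, z = 0 → star z = 0 := fun h => by rw [h, star_zero]
  replace h1 := And.intro h1 (cj h1)
  replace h2 := And.intro h2 (cj h2)
  replace h3 := And.intro h3 (cj h3)
  replace h4 := And.intro h4 (cj h4)
  replace h5 := And.intro h5 (cj h5)
  replace h6 := And.intro h6 (cj h6)
  replace h7 := And.intro h7 (cj h7)
  replace h8 := And.intro h8 (cj h8)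
  replace h9 := And.intro h9 (cj h9)
  replace h10 := And.intro h10 (cj h10)
  replace h11 := And.intro h11 (cj h11)
  replace h12 := And.intro h12 (cj h12)
  replace h13 := And.intro h13 (cj h13)
  replace h14 := And.intro h14 (cj h14)
  replace h15 := And.intro h15 (cj h15)
  replace h16 := And.intro h16 (cj h16)
  replace h17 := And.intro h17 (cj h17)
  replace h18 := And.intro h18 (cj h18)
  simp only [one_div, mul_eq_zero, inv_eq_zero, OfNat.ofNat_ne_zero, false_or, star_neg, star_mul',
    star_sub, star_inv₀, star_ofNat, s, neg_eq_zero, conjIdx_zero, conjIdx_one,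
    conjIdx_two, conjIdx_three]
    at h1 h2 h3 h4 h5 h6 h7 h8 h9 h10 h11 h12 h13 h14 h15 h16 h17 h18
  clear s cj
  intro a b c f
  refine eq_zero_of_antisymm (A := fun a b => F.defect a b c f x) (fun a b => l a b c f)
    ?_ ?_ ?_ ?_ ?_ ?_ a b <;>
  refine eq_zero_of_antisymm (A := fun c f => F.defect _ _ c f x) (fun c f => r _ _ c f)
    ?_ ?_ ?_ ?_ ?_ ?_ c f <;> grind

/-- The cyclic sum is totally antisymmetric in its last three indices, leaving four triples for each
of four first indices: sixteen real conditions once reality is used. They match four imaginary and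
six complex Newman–Penrose combinations. -/
theorem jacobiAt_iff_jacobiNPAt (hU : IsOpen U) (hx : x ∈ U) : F.JacobiAt x ↔ F.JacobiNPAt x := by
  have l := hF.defect_antisymm_left hU hx
  have r := hF.defect_antisymm_right hx
  have s := hF.star_defect hU hx
  have rd : ∀ a b c, F.defect a b c c x = 0 := fun a b c => by
    linear_combination (1 / 2) * r a b c c
  have h2 : star (2 : ℂ) = 2 := star_ofNat 2
  rw [hF.jacobiAt_iff_defect hU hx]
  obtain ⟨n1, n2, n3, n4, n5, n6, n7, n8, n9, n10, n11, n12, n13, n14, n15, n16, n17, n18⟩ :=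
    hF.np_eq_defect hU hx
  simp only [JacobiNPAt, Pi.sub_apply, Pi.add_apply, Pi.mul_apply, Pi.star_apply, Pi.ofNat_apply,
    n1, n3, n4, n5, n6, n7, n8, n9, n11, n12, n13, n14, n15, n16, n17, n18, star_neg, star_mul',
    star_sub, star_div₀, star_one, h2, s, conjIdx_zero, conjIdx_one, conjIdx_two, conjIdx_three]
  constructor
  · intro h
    have t : ∀ a, F.defect a 0 1 2 x + F.defect a 1 2 0 x + F.defect a 2 0 1 x = 0 ∧
        F.defect a 0 1 3 x + F.defect a 1 3 0 x + F.defect a 3 0 1 x = 0 ∧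
        F.defect a 0 2 3 x + F.defect a 2 3 0 x + F.defect a 3 0 2 x = 0 ∧
        F.defect a 1 2 3 x + F.defect a 2 3 1 x + F.defect a 3 1 2 x = 0 :=
      fun a => ⟨h _ _ _ _, h _ _ _ _, h _ _ _ _, h _ _ _ _⟩
    have t0 := t 0
    have t1 := t 1
    have t2 := t 2
    have t3 := t 3
    refine ⟨?_, ?_, ?_, ?_, ?_, ?_, ?_, ?_, ?_, ?_⟩ <;> grind
  · rintro ⟨h1, h2, h3, h4, h5, h6, h7, h8, h9, h10⟩ h a b c
    have cj : ∀ {z : ℂ}, z = 0 → star z = 0 := fun h => by rw [h, star_zero]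
    -- The first four combinations are imaginary, so their conjugates add nothing.
    replace h5 := And.intro h5 (cj h5)
    replace h6 := And.intro h6 (cj h6)
    replace h7 := And.intro h7 (cj h7)
    replace h8 := And.intro h8 (cj h8)
    replace h9 := And.intro h9 (cj h9)
    replace h10 := And.intro h10 (cj h10)
    simp only [star_neg, star_mul', star_add, star_sub, star_div₀, star_one, star_ofNat, s,
      conjIdx_zero, conjIdx_one, conjIdx_two, conjIdx_three] at h5 h6 h7 h8 h9 h10
    clear s cj
    refine eq_zero_of_cyclic (T := fun a b c =>
      F.defect h a b c x + F.defect h b c a x + F.defect h c a b x) ?_ ?_ ?_ ?_ ?_ ?_ a b c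
    · intro a b c
      ring
    · intro a b c
      linear_combination r h a b c + r h b c a + r h c a b
    all_goals fin_cases h <;> simp only [Fin.zero_eta, Fin.mk_one, Fin.reduceFinMk] <;> grind

/-- The six single equations are row `03` of the defect, and conjugation gives row `13`. In the four
combined expressions row `01` cancels, leaving the components of row `32` up to sign and
conjugation. -/
theorem ricciAt_iff_ricciNPAt (hU : IsOpen U) (hx : x ∈ U) : F.RicciAt x ↔ F.RicciNPAt x := by
  have l := hF.defect_antisymm_left hU hx
  have r := hF.defect_antisymm_right hx
  have s := hF.star_defect hU hx
  have h2 : star (2 : ℂ) = 2 := star_ofNat 2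
  rw [ricciAt_iff_defect]
  obtain ⟨n1, n2, n3, n4, n5, n6, n7, n8, n9, n10, n11, n12, n13, n14, n15, n16, n17, n18⟩ :=
    hF.np_eq_defect hU hx
  simp only [RicciNPAt, Pi.sub_apply, Pi.add_apply, Pi.star_apply,
    n1, n2, n3, n4, n5, n6, n11, n12, n15, n16, n17, n18, star_mul',
    star_sub, star_div₀, star_one, h2, s, conjIdx_zero, conjIdx_one, conjIdx_two, conjIdx_three]
  constructor
  · intro h
    have t := h 2
    refine ⟨h _ _ _, h _ _ _, h _ _ _, h _ _ _, h _ _ _, h _ _ _, ?_, ?_, ?_, ?_⟩ <;> grind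
  · rintro ⟨h1, h2, h3, h4, h5, h6, h7, h8, h9, h10⟩ a c f
    have cj : ∀ {z : ℂ}, z = 0 → star z = 0 := fun h => by rw [h, star_zero]
    replace h1 := And.intro h1 (cj h1)
    replace h2 := And.intro h2 (cj h2)
    replace h3 := And.intro h3 (cj h3)
    replace h4 := And.intro h4 (cj h4)
    replace h5 := And.intro h5 (cj h5)
    replace h6 := And.intro h6 (cj h6)
    replace h7 := And.intro h7 (cj h7)
    replace h8 := And.intro h8 (cj h8)
    simp only [star_mul', star_add, star_sub, star_div₀, star_one, star_ofNat, s,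
      conjIdx_zero, conjIdx_one, conjIdx_two, conjIdx_three] at h1 h2 h3 h4 h5 h6 h7 h8
    clear s cj
    refine eq_zero_of_antisymm (A := fun c f => F.defect a 3 c f x) (fun c f => r _ _ c f)
      ?_ ?_ ?_ ?_ ?_ ?_ c f <;> fin_cases a <;>
      simp only [Fin.zero_eta, Fin.mk_one, Fin.reduceFinMk] <;> grind

end IsAdmissibleOn

/-- Pure linear algebra in the eighteen values and their conjugates; no property of the fields is
used. -/
theorem allNPAt_iff : F.AllNPAt x ↔ F.JacobiNPAt x ∧ F.RicciNPAt x ∧ F.FieldNPAt x := by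
  have cj : ∀ {z : ℂ}, z = 0 → star z = 0 := fun h => by rw [h, star_zero]
  simp only [AllNPAt, JacobiNPAt, RicciNPAt, FieldNPAt, Pi.sub_apply, Pi.add_apply, Pi.mul_apply,
    Pi.star_apply, Pi.ofNat_apply]
  constructor
  · intro h
    simp [h]
  · rintro ⟨⟨-, j2, j3, j4, j5, j6, j7, j8, j9, j10⟩,
      ⟨r1, r2, r3, r11, r16, r17, r4, r15, r6, r12⟩, ⟨f10, f13, f12, f14⟩⟩
    have h8 : F.NP8 x = 0 := by linear_combination j6 - r17
    have h7 : F.NP7 x = 0 := by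
      have : star (F.NP7 x) = 0 := by linear_combination r16 - j5
      exact star_eq_zero.mp this
    have h4 : F.NP4 x = 0 := by linear_combination (1 / 2) * (j7 + cj r3 + cj r11)
    have h5 : F.NP5 x = 0 := by linear_combination (1 / 2) * (j8 + r3 - r11)
    have h6 : F.NP6 x = 0 := by linear_combination (1 / 2) * (r6 - j4 + h8 - cj h8)
    have h12 : F.NP12 x = 0 := by linear_combination (1 / 2) * (f12 - r12)
    have h14 : F.NP14 x = 0 := by linear_combination (1 / 2) * (f14 - j2)
    have k10 := cj j10
    simp only [star_add, star_sub, star_mul', star_ofNat] at k10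
    -- Subtracting the conjugated relation for `NP18` from that for `NP15` cancels `NP13`, so `NP9`
    -- vanishes without a field equation. Only then does `NP13 = 0` yield `NP15` and `NP18`.
    have h9 : F.NP9 x = 0 := by
      have : star (F.NP9 x) = 0 := by linear_combination r15 - (1 / 2) * j9 + (1 / 2) * k10
      exact star_eq_zero.mp this
    have h15 : F.NP15 x = 0 := by linear_combination (1 / 2) * (j9 + cj h9 + cj f13)
    have h18 : F.NP18 x = 0 := by linear_combination (1 / 2) * (j10 - h9 + f13)
    exact ⟨r1, r2, r3, h4, h5, h6, h7, h8, h9, f10, r11, h12, f13, h14, h15, r16, r17, h18⟩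

end Fields

section Model

open Complex

/-! ### A model with prescribed values of the field equations -/

theorem dirDeriv_coord (v : VecField) (i : Fin 4) (x : Coord) :
    dirDeriv v (fun y => (y i : ℂ)) x = v x i := by
  have h : HasFDerivAt (fun y : Coord => (y i : ℂ))
      (ofRealCLM.comp (ContinuousLinearMap.proj (R := ℝ) (φ := fun _ : Fin 4 => ℝ) i)) x :=
    (ofRealCLM.comp (ContinuousLinearMap.proj (R := ℝ) (φ := fun _ : Fin 4 => ℝ) i)).hasFDerivAt
  simp only [dirDeriv, h.fderiv]
  simp [Pi.single_apply, apply_ite]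

/-- The complex linear function with derivative `p` along `ℓ`, and `q`, `r` along `m`, `m̄` in the
tetrad `modelTetrad`. -/
def linearScalar (p q r : ℂ) : Scalar := fun y =>
  p * y 2 + (q + r) / 2 * y 0 + (r - q) * I / 2 * y 1

/-- A tetrad whose only nonzero commutators are `[k, m] = [k, m̄] = -ℓ`. -/
def modelTetrad : Tetrad where
  m := fun y => ![1, I, -y 3, 0]
  l := fun _ => ![0, 0, 1, 0]
  k := fun _ => ![0, 0, 0, 1]

/-- Connection coefficients with given `λ`, `ν`, `α`, `γ` and their conjugates,
`κ = 1`, and vanishing remaining spin coefficients, before antisymmetrization. -/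
def modelConn (lam lamb nu nub al alb ga gab : Scalar) : Fin 4 → Fin 4 → Fin 4 → Scalar :=
  ![![0, ![alb, -al, gab - ga, 0], ![lamb, 0, nub, 0], ![0, 0, 0, -1]],
    ![0, 0, ![0, lam, nu, 0], ![0, 0, 0, -1]],
    0,
    ![0, 0, ![alb, al, ga + gab, 0], 0]]

/-- The variables with `NP10 = a`, `NP13 = b`, `NP12 = c / 2`, `NP14 = d / 2` at the origin. -/
def modelFields (a b : ℂ) (c d : ℝ) : Fields where
  t := modelTetrad
  Γ := fun i j h y =>
    modelConn (linearScalar a b 0) (linearScalar (star a) 0 (star b))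
      (linearScalar 0 (d / 2) 0) (linearScalar 0 0 (d / 2))
      (linearScalar (b / 2) (c / 2) 0) (linearScalar (star b / 2) 0 (c / 2))
      (linearScalar 0 (star b / 2) 0) (linearScalar 0 0 (b / 2)) i j h y -
    modelConn (linearScalar a b 0) (linearScalar (star a) 0 (star b))
      (linearScalar 0 (d / 2) 0) (linearScalar 0 0 (d / 2))
      (linearScalar (b / 2) (c / 2) 0) (linearScalar (star b / 2) 0 (c / 2))
      (linearScalar 0 (star b / 2) 0) (linearScalar 0 0 (b / 2)) j i h y
  Rm := 0

theorem star_linearScalar (p q r : ℂ) (y : Coord) :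
    star (linearScalar p q r y) = linearScalar (star p) (star r) (star q) y := by
  simp only [linearScalar, star_def, map_add, map_mul, map_div₀, map_sub, conj_ofReal, conj_I,
    map_ofNat]
  ring

theorem contDiff_linearScalar (p q r : ℂ) : ContDiff ℝ ∞ (linearScalar p q r) := by
  have h : ∀ i : Fin 4, ContDiff ℝ ∞ (fun y : Coord => (y i : ℂ)) := fun i =>
    ofRealCLM.contDiff.comp (contDiff_apply ℝ ℝ i)
  exact ((contDiff_const.mul (h 2)).add (contDiff_const.mul (h 0))).add (contDiff_const.mul (h 1))

theorem linearScalar_zero_apply (p q r : ℂ) : linearScalar p q r 0 = 0 := by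
  simp [linearScalar]

theorem dirDeriv_linearScalar (v : VecField) (p q r : ℂ) (x : Coord) :
    dirDeriv v (linearScalar p q r) x
      = p * v x 2 + (q + r) / 2 * v x 0 + (r - q) * I / 2 * v x 1 := by
  have h : ∀ i : Fin 4, DifferentiableAt ℝ (fun y : Coord => (y i : ℂ)) x := fun i =>
    (ofRealCLM.differentiable.comp (differentiable_apply (𝕜 := ℝ) i)).differentiableAt
  have h' : ∀ (c : ℂ) (i : Fin 4), DifferentiableAt ℝ (fun y : Coord => c * (y i : ℂ)) x :=
    fun c i => (h i).const_mul c
  have e : linearScalar p q r = fun y : Coord => p * y 2 + (q + r) / 2 * y 0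
    + (r - q) * I / 2 * y 1 := rfl
  rw [e, dirDeriv_add ((h' _ _).fun_add (h' _ _)) (h' _ _), dirDeriv_add (h' _ _) (h' _ _),
    dirDeriv_const_mul _ (h _), dirDeriv_const_mul _ (h _), dirDeriv_const_mul _ (h _),
    dirDeriv_coord, dirDeriv_coord, dirDeriv_coord]

theorem modelFields_isAdmissibleOn (a b : ℂ) (c d : ℝ) :
    (modelFields a b c d).IsAdmissibleOn Set.univ where
  tetrad_smooth := by
    refine ⟨?_, contDiffOn_const, contDiffOn_const⟩
    refine contDiffOn_pi.mpr fun i => ContDiff.contDiffOn ?_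
    fin_cases i <;> simp [modelFields, modelTetrad]
    · exact contDiff_const
    · exact contDiff_const
    · exact (ofRealCLM.contDiff.comp (contDiff_apply ℝ ℝ 3)).neg
    · exact contDiff_const
  conn_smooth := by
    intro i j h
    have hl := contDiff_linearScalar
    refine ContDiff.contDiffOn ?_
    have : ∀ i j h, ContDiff ℝ ∞ (modelConn (linearScalar a b 0) (linearScalar (star a) 0 (star b))
      (linearScalar 0 (d / 2) 0) (linearScalar 0 0 (d / 2))
      (linearScalar (b / 2) (c / 2) 0) (linearScalar (star b / 2) 0 (c / 2))
      (linearScalar 0 (star b / 2) 0) (linearScalar 0 0 (b / 2)) i j h) := by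
      intro i j h
      fin_cases i <;> fin_cases j <;> fin_cases h <;>
        first
        | exact contDiff_const
        | exact hl _ _ _
        | exact (hl _ _ _).neg
        | exact (contDiff_const (c := (1 : ℂ))).neg
        | exact (hl _ _ _).sub (hl _ _ _)
        | exact (hl _ _ _).add (hl _ _ _)
    exact (this i j h).sub (this j i h)
  conn_antisymm := fun y _ i j h => (neg_sub _ _).symm
  conn_real := by
    intro y _ i j h
    fin_cases i <;> fin_cases j <;> fin_cases h <;>
      simp [modelFields, modelConn, star_linearScalar, -star_def, conjIdx] <;> ring
  curv := by
    constructor <;> intros <;> simp [modelFields]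
    exact contDiffOn_const

theorem modelFields_spin (a b : ℂ) (c d : ℝ) :
    (modelFields a b c d).κ = (fun _ => 1) ∧ (modelFields a b c d).ρ = (fun _ => 0) ∧
    (modelFields a b c d).σ = (fun _ => 0) ∧ (modelFields a b c d).τ = (fun _ => 0) ∧
    (modelFields a b c d).μ = (fun _ => 0) ∧ (modelFields a b c d).π = (fun _ => 0) ∧
    (modelFields a b c d).ε = (fun _ => 0) ∧ (modelFields a b c d).β = (fun _ => 0) ∧
    (modelFields a b c d).ν = linearScalar 0 (d / 2) 0 ∧
    (modelFields a b c d).lam = linearScalar a b 0 ∧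
    (modelFields a b c d).α = linearScalar (b / 2) (c / 2) 0 ∧
    (modelFields a b c d).γ = linearScalar 0 (star b / 2) 0 := by
  refine ⟨?_, ?_, ?_, ?_, ?_, ?_, ?_, ?_, ?_, ?_, ?_, ?_⟩ <;> funext y <;>
    simp [Fields.κ, Fields.ρ, Fields.σ, Fields.τ, Fields.μ, Fields.π, Fields.ε, Fields.β,
      Fields.ν, Fields.lam, Fields.α, Fields.γ, modelFields, modelConn, -star_def] <;> ring

theorem modelFields_curv (a b : ℂ) (c d : ℝ) :
    (modelFields a b c d).R = 0 ∧ (∀ i j, (modelFields a b c d).Ric i j = 0) ∧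
    (∀ i j h l, (modelFields a b c d).Weyl i j h l = 0) := by
  refine ⟨?_, fun i j => ?_, fun i j h l => ?_⟩ <;> funext y <;>
    simp [Fields.Weyl, Fields.R, Fields.Ric, modelFields]

/-- At the origin every product in the Newman–Penrose equations contains a vanishing spin
coefficient, because `κ` never occurs there without such a factor. The first derivatives of `λ`,
`ν`, `α`, `γ` are therefore the values of the expressions, and the Bianchi equations are trivial for
`Rm = 0`. -/
theorem exists_isAdmissibleOn_fieldNP (a b : ℂ) (c d : ℝ) : ∃ (F : Fields) (x : Coord),
    F.IsAdmissibleOn Set.univ ∧ LinearIndependent ℂ (fun i => F.t.e i x) ∧ F.κ x ≠ 0 ∧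
    F.CommutatorsAt x ∧ F.JacobiNPAt x ∧ F.RicciNPAt x ∧ F.BianchiAt x ∧
    F.NP10 x = a ∧ F.NP13 x = b ∧
    (F.NP12 + star F.NP12) x = c ∧ (F.NP14 + star F.NP14) x = d := by
  obtain ⟨hκ, hρ, hσ, hτ, hμ, hπ, hε, hβ, hν, hlam, hα, hγ⟩ := modelFields_spin a b c d
  obtain ⟨hR, hRic, hW⟩ := modelFields_curv a b c d
  have hlin := linearScalar_zero_apply
  have hdl : ∀ i p q r, (modelFields a b c d).d i (linearScalar p q r) 0 = ![q, r, p, 0] i := by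
    intro i p q r
    simp only [Fields.d, dirDeriv_linearScalar]
    fin_cases i <;> simp [modelFields, modelTetrad, Tetrad.e] <;> ring_nf <;> simp <;> ring
  have hdc : ∀ i (z : ℂ), (modelFields a b c d).d i (fun _ => z) 0 = 0 := fun i z =>
    dirDeriv_const _ _ _
  -- `NP15` and `NP18` cannot be zero in general: with `NP9 = 0` the Jacobi part forces `star b / 2`
  -- and `b / 2`. This dictates the derivative of `γ` along `m` and that of `α` along `ℓ`.
  have hnp : (modelFields a b c d).NP1 0 = 0 ∧ (modelFields a b c d).NP2 0 = 0 ∧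
      (modelFields a b c d).NP3 0 = 0 ∧ (modelFields a b c d).NP4 0 = 0 ∧
      (modelFields a b c d).NP5 0 = 0 ∧ (modelFields a b c d).NP6 0 = 0 ∧
      (modelFields a b c d).NP7 0 = 0 ∧ (modelFields a b c d).NP8 0 = 0 ∧
      (modelFields a b c d).NP9 0 = 0 ∧ (modelFields a b c d).NP10 0 = a ∧
      (modelFields a b c d).NP11 0 = 0 ∧ (modelFields a b c d).NP12 0 = c / 2 ∧
      (modelFields a b c d).NP13 0 = b ∧ (modelFields a b c d).NP14 0 = d / 2 ∧
      (modelFields a b c d).NP15 0 = star b / 2 ∧ (modelFields a b c d).NP16 0 = 0 ∧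
      (modelFields a b c d).NP17 0 = 0 ∧ (modelFields a b c d).NP18 0 = b / 2 := by
    refine ⟨?_, ?_, ?_, ?_, ?_, ?_, ?_, ?_, ?_, ?_, ?_, ?_, ?_, ?_, ?_, ?_, ?_, ?_⟩ <;>
      simp [Fields.NP1, Fields.NP2, Fields.NP3, Fields.NP4, Fields.NP5, Fields.NP6, Fields.NP7,
        Fields.NP8, Fields.NP9, Fields.NP10, Fields.NP11, Fields.NP12, Fields.NP13, Fields.NP14,
        Fields.NP15, Fields.NP16, Fields.NP17, Fields.NP18, Fields.D, Fields.Δ, Fields.δ,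
        Fields.δb, Fields.Ψ0, Fields.Ψ1, Fields.Ψ2, Fields.Ψ3, Fields.Ψ4, Fields.Φ00, Fields.Φ01,
        Fields.Φ10, Fields.Φ02, Fields.Φ20, Fields.Φ11, Fields.Φ12, Fields.Φ21, Fields.Φ22,
        hR, hRic, hW, hκ, hρ, hσ, hτ, hμ, hπ, hε, hβ, hν, hlam, hα, hγ, hdl, hdc, hlin,
        -star_def]
  obtain ⟨n1, n2, n3, n4, n5, n6, n7, n8, n9, n10, n11, n12, n13, n14, n15, n16, n17, n18⟩ := hnp
  refine ⟨modelFields a b c d, 0, modelFields_isAdmissibleOn a b c d, ?_, ?_, ?_, ?_, ?_, ?_,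
    n10, n13, ?_, ?_⟩
  · rw [Fintype.linearIndependent_iff]
    intro g hg
    have h0 := congrFun hg 0
    have h1 := congrFun hg 1
    have h2 := congrFun hg 2
    have h3 := congrFun hg 3
    simp [Fin.sum_univ_four, modelFields, modelTetrad, Tetrad.e] at h0 h1 h2 h3
    have h1' : g 0 - g 1 = 0 := by linear_combination -I * h1 + (g 0 - g 1) * I_mul_I
    intro i
    fin_cases i
    · show g 0 = 0
      linear_combination (1 / 2) * (h0 + h1')
    · show g 1 = 0
      linear_combination (1 / 2) * (h0 - h1')
    · exact h2
    · exact h3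
  · simp [hκ]
  -- The only nonconstant frame component is the entry `-y 3` of `m` and `m̄`, seen only by the
  -- derivative along `k`. The resulting `-1` equals the commutation coefficient `-κ`, so `κ = 1`
  -- requires this term.
  · have he : ∀ i j h, (modelFields a b c d).d i (fun y => modelTetrad.e j y h) 0
        = if i = 3 ∧ h = 2 ∧ (j = 0 ∨ j = 1) then -1 else 0 := by
      have h3 : ∀ v : VecField, dirDeriv v (fun y => -(y 3 : ℂ)) 0 = -v 0 3 := fun v => by
        rw [dirDeriv_neg, dirDeriv_coord]
      intro i j h
      fin_cases j <;> fin_cases h <;> simp [Fields.d, modelTetrad, Tetrad.e, h3] <;>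
        fin_cases i <;> simp [modelFields, modelTetrad]
    intro i j h
    have ht : (modelFields a b c d).t = modelTetrad := rfl
    rw [ht, he, he]
    simp only [Fields.comm, Fields.Γup_zero, Fields.Γup_one, Fields.Γup_two, Fields.Γup_three,
      Fin.sum_univ_four]
    fin_cases h <;> fin_cases i <;> fin_cases j <;>
      simp [modelFields, modelConn, modelTetrad, Tetrad.e, hlin]
  · simp [Fields.JacobiNPAt, n1, n3, n4, n5, n6, n7, n8, n9, n11, n12, n13, n14, n15, n16, n17,
      n18]
    constructor <;> ring
  · simp [Fields.RicciNPAt, n1, n2, n3, n11, n16, n17, n4, n5, n15, n18, n6, n12]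
  · intro i j h l s
    simp [Fields.covRm, modelFields, Fields.d, dirDeriv]
  · simp [n12]
  · simp [n14]

end Model

/-! ### The Levi-Civita connection in a null tetrad -/

theorem contDiffOn_fderiv_apply {E : Type*} [NormedAddCommGroup E] [NormedSpace ℝ E]
    {U : Set Coord} (hU : IsOpen U) {f : Coord → E}
    (hf : ContDiffOn ℝ ∞ f U) (v : Coord) : ContDiffOn ℝ ∞ (fun x => fderiv ℝ f x v) U :=
  (hf.fderiv_of_isOpen hU (by simp)).clm_apply contDiffOn_const

theorem contDiffOn_dirDeriv {U : Set Coord} (hU : IsOpen U) {v : VecField} {f : Scalar}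
    (hv : ∀ i, ContDiffOn ℝ ∞ (fun x => v x i) U) (hf : ContDiffOn ℝ ∞ f U) :
    ContDiffOn ℝ ∞ (dirDeriv v f) U :=
  ContDiffOn.sum fun i _ => (hv i).mul (contDiffOn_fderiv_apply hU hf _)

theorem contDiffOn_ofReal {U : Set Coord} {f : Coord → ℝ} (hf : ContDiffOn ℝ ∞ f U) :
    ContDiffOn ℝ ∞ (fun x => (f x : ℂ)) U :=
  Complex.ofRealCLM.contDiff.comp_contDiffOn hf

theorem fderiv_ofReal_apply {f : Coord → ℝ} {x : Coord} (hf : DifferentiableAt ℝ f x) (v : Coord) :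
    fderiv ℝ (fun y => (f y : ℂ)) x v = (fderiv ℝ f x v : ℂ) := by
  have h : HasFDerivAt (fun y => (f y : ℂ)) (Complex.ofRealCLM.comp (fderiv ℝ f x)) x :=
    Complex.ofRealCLM.hasFDerivAt.comp x hf.hasFDerivAt
  rw [h.fderiv]
  rfl

theorem eta_mul_eta : eta * eta = 1 := by
  ext i j
  fin_cases i <;> fin_cases j <;> simp [eta, Matrix.mul_apply, Fin.sum_univ_four]

theorem Tetrad.SmoothOn.e {t : Tetrad} {U : Set Coord} (ht : t.SmoothOn U) (a i : Fin 4) :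
    ContDiffOn ℝ ∞ (fun x => t.e a x i) U := by
  obtain ⟨hm, hl, hk⟩ := ht
  have hm' := contDiffOn_pi.mp hm i
  fin_cases a
  · exact hm'
  · exact (starL' ℝ (A := ℂ)).contDiff.comp_contDiffOn hm'
  · exact contDiffOn_ofReal (contDiffOn_pi.mp hl i)
  · exact contDiffOn_ofReal (contDiffOn_pi.mp hk i)

section Star

variable (g : Coord → Matrix (Fin 4) (Fin 4) ℝ) (V W : VecField) (x : Coord)

theorem star_metricInner : star (metricInner g V W x)
    = metricInner g (fun y i => star (V y i)) (fun y i => star (W y i)) x := by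
  simp [metricInner]

theorem star_covDeriv (i : Fin 4) : star (covDeriv g V W x i)
    = covDeriv g (fun y i => star (V y i)) (fun y i => star (W y i)) x i := by
  simp only [covDeriv, star_add, dirDeriv_star, star_sum, star_mul', Complex.star_def,
    Complex.conj_ofReal]

end Star

namespace IsNullTetradOn

variable {U : Set Coord} {g : Coord → Matrix (Fin 4) (Fin 4) ℝ} {t : Tetrad} {x : Coord}
  (hN : IsNullTetradOn U g t)
include hN

/-- The inner products say `Mᵀ g M = η` for the frame matrix `M`. As `η² = 1` and one-sided inverses
of square matrices are two-sided, `M η Mᵀ` inverts `g`. Completeness of the frame and nondegeneracy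
of the metric both follow. -/
theorem frame_mul_metric (hx : x ∈ U) :
    (Matrix.of fun i a => t.e a x i) * eta * (Matrix.of fun i a => t.e a x i).transpose
      * (g x).map Complex.ofReal = 1 := by
  set M : Matrix (Fin 4) (Fin 4) ℂ := Matrix.of fun i a => t.e a x i with hM
  have h : M.transpose * (g x).map Complex.ofReal * M = eta := by
    ext a b
    rw [← hN.inner_eq x hx a b]
    simp only [Matrix.mul_apply, Matrix.transpose_apply, Matrix.map_apply, hM, Matrix.of_apply,
      metricInner, Finset.sum_mul]
    rw [Finset.sum_comm]
    exact Finset.sum_congr rfl fun _ _ => Finset.sum_congr rfl fun _ _ => by ring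
  have h' : (eta * M.transpose * (g x).map Complex.ofReal) * M = 1 := by
    rw [Matrix.mul_assoc, Matrix.mul_assoc, ← Matrix.mul_assoc M.transpose, h, eta_mul_eta]
  rw [mul_eq_one_comm] at h'
  rw [← h']
  simp only [Matrix.mul_assoc]

/-- Every vector is a combination of the tetrad vectors. -/
theorem sum_frame (hx : x ∈ U) (V : VecField) (i : Fin 4) :
    ∑ a, (∑ b, eta a b * metricInner g (t.e b) V x) * t.e a x i = V x i := by
  have h := congrFun (congrArg (fun A => Matrix.mulVec A (V x)) (hN.frame_mul_metric hx)) i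
  simp only [Matrix.one_mulVec] at h
  rw [← h]
  simp only [metricInner, Matrix.mulVec, dotProduct, Matrix.mul_apply, Matrix.transpose_apply,
    Matrix.map_apply, Matrix.of_apply, Fin.sum_univ_four]
  ring

theorem isUnit_det_metric (hx : x ∈ U) : IsUnit (g x).det := by
  have h : IsUnit ((g x).map Complex.ofReal).det :=
    Matrix.isUnit_det_of_left_inverse (hN.frame_mul_metric hx)
  have h' : ((g x).map Complex.ofReal).det = ((g x).det : ℂ) :=
    (RingHom.map_det Complex.ofRealHom (g x)).symm
  rw [h', isUnit_iff_ne_zero] at h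
  exact isUnit_iff_ne_zero.mpr (by exact_mod_cast h)

theorem inv_metric_apply (hx : x ∈ U) (i j : Fin 4) :
    (((g x)⁻¹ i j : ℝ) : ℂ) = ∑ a, ∑ b, eta a b * t.e a x i * t.e b x j := by
  set M : Matrix (Fin 4) (Fin 4) ℂ := Matrix.of fun i a => t.e a x i with hM
  have h1 : (g x).map Complex.ofReal * (g x)⁻¹.map Complex.ofReal = 1 := by
    change (g x).map Complex.ofRealHom * (g x)⁻¹.map Complex.ofRealHom = 1
    rw [← Matrix.map_mul, Matrix.mul_nonsing_inv _ (hN.isUnit_det_metric hx),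
      Matrix.map_one _ (map_zero _) (map_one _)]
  have h2 : (g x)⁻¹.map Complex.ofReal = M * eta * M.transpose := by
    rw [← Matrix.one_mul ((g x)⁻¹.map Complex.ofReal), ← hN.frame_mul_metric hx,
      Matrix.mul_assoc _ ((g x).map Complex.ofReal), h1, Matrix.mul_one]
  have h3 := congrFun (congrFun h2 i) j
  rw [Matrix.map_apply] at h3
  rw [h3]
  simp only [Matrix.mul_apply, Matrix.transpose_apply, hM, Matrix.of_apply, Finset.sum_mul]
  rw [Finset.sum_comm]
  exact Finset.sum_congr rfl fun _ _ => Finset.sum_congr rfl fun _ _ => by ring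

/-- The inverse metric is a polynomial in the tetrad components, so its smoothness needs no argument
about matrix inversion. -/
theorem contDiffOn_christoffel (hU : IsOpen U) (i j k : Fin 4) :
    ContDiffOn ℝ ∞ (fun x => (christoffel g i j k x : ℂ)) U := by
  have he := hN.tetrad_smooth.e
  have hd : ∀ j k l, ContDiffOn ℝ ∞
      (fun x => fderiv ℝ (fun y => g y j k) x (Pi.single l 1)) U := fun j k l =>
    contDiffOn_fderiv_apply hU (hN.metric_smooth j k) _
  have h : ContDiffOn ℝ ∞ (fun x => (1 / 2 : ℂ) * ∑ l,
      (∑ a, ∑ b, eta a b * t.e a x i * t.e b x l) *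
      ((fderiv ℝ (fun y => g y l k) x (Pi.single j 1)
        + fderiv ℝ (fun y => g y l j) x (Pi.single k 1)
        - fderiv ℝ (fun y => g y j k) x (Pi.single l 1) : ℝ) : ℂ)) U := by
    refine contDiffOn_const.mul (ContDiffOn.sum fun l _ => ContDiffOn.mul ?_ ?_)
    · exact ContDiffOn.sum fun a _ => ContDiffOn.sum fun b _ =>
        (contDiffOn_const.mul (he a i)).mul (he b l)
    · exact contDiffOn_ofReal (((hd _ _ _).add (hd _ _ _)).sub (hd _ _ _))
  refine h.congr fun x hx => ?_
  simp only [christoffel, Complex.ofReal_mul, Complex.ofReal_sum, hN.inv_metric_apply hx]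
  norm_num

theorem contDiffOn_covDeriv (hU : IsOpen U) (a b i : Fin 4) :
    ContDiffOn ℝ ∞ (fun x => covDeriv g (t.e a) (t.e b) x i) U := by
  have he := hN.tetrad_smooth.e
  exact (contDiffOn_dirDeriv hU (he a) (he b i)).add
    (ContDiffOn.sum fun j _ => ContDiffOn.sum fun k _ =>
      ((hN.contDiffOn_christoffel hU i j k).mul (he a j)).mul (he b k))

theorem metric_symm_apply (hx : x ∈ U) (i j : Fin 4) : g x i j = g x j i :=
  (hN.metric_symm x hx).apply j i

theorem fderiv_metric_symm (hU : IsOpen U) (hx : x ∈ U) (i j : Fin 4) :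
    fderiv ℝ (fun y => g y i j) x = fderiv ℝ (fun y => g y j i) x :=
  Filter.EventuallyEq.fderiv_eq
    (Filter.eventually_of_mem (hU.mem_nhds hx) fun _ hy => hN.metric_symm_apply hy i j)

theorem christoffel_symm (hU : IsOpen U) (hx : x ∈ U) (i j k : Fin 4) :
    christoffel g i j k x = christoffel g i k j x := by
  simp only [christoffel, hN.fderiv_metric_symm hU hx j k]
  congr 1
  exact Finset.sum_congr rfl fun _ _ => by ring

theorem metric_mul_christoffel (hx : x ∈ U) (i j k : Fin 4) :
    ∑ m, g x i m * christoffel g m j k x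
      = (1 / 2) * (fderiv ℝ (fun y => g y i k) x (Pi.single j 1)
      + fderiv ℝ (fun y => g y i j) x (Pi.single k 1)
      - fderiv ℝ (fun y => g y j k) x (Pi.single i 1)) := by
  set A : Fin 4 → ℝ := fun l => fderiv ℝ (fun y => g y l k) x (Pi.single j 1)
      + fderiv ℝ (fun y => g y l j) x (Pi.single k 1)
      - fderiv ℝ (fun y => g y j k) x (Pi.single l 1) with hA
  have h := congrFun (congrArg (fun B => Matrix.mulVec B A)
    (Matrix.mul_nonsing_inv (g x) (hN.isUnit_det_metric hx))) i
  simp only [Matrix.one_mulVec, ← Matrix.mulVec_mulVec] at h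
  change _ = (1 / 2) * A i
  rw [← h]
  simp only [Matrix.mulVec, dotProduct, christoffel, Finset.mul_sum]
  exact Finset.sum_congr rfl fun _ _ => Finset.sum_congr rfl fun _ _ => by ring

theorem fderiv_metric (hU : IsOpen U) (hx : x ∈ U) (i j k : Fin 4) :
    fderiv ℝ (fun y => g y i j) x (Pi.single k 1)
      = ∑ m, (g x j m * christoffel g m k i x + g x i m * christoffel g m k j x) := by
  rw [Finset.sum_add_distrib, hN.metric_mul_christoffel hx, hN.metric_mul_christoffel hx,
    hN.fderiv_metric_symm hU hx j i, hN.fderiv_metric_symm hU hx j k,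
    hN.fderiv_metric_symm hU hx i k]
  ring

theorem dirDeriv_metric (hU : IsOpen U) (hx : x ∈ U) (V : VecField) (i j : Fin 4) :
    dirDeriv V (fun y => (g y i j : ℂ)) x
      = ∑ m, ((g x m j : ℂ) * ∑ k, (christoffel g m k i x : ℂ) * V x k
        + (g x i m : ℂ) * ∑ k, (christoffel g m k j x : ℂ) * V x k) := by
  have hd : DifferentiableAt ℝ (fun y => g y i j) x :=
    ((hN.metric_smooth i j).contDiffAt (hU.mem_nhds hx)).differentiableAt (by simp)
  simp only [dirDeriv, fderiv_ofReal_apply hd, hN.fderiv_metric hU hx, hN.metric_symm_apply hx j]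
  push_cast
  simp only [Fin.sum_univ_four]
  ring

/-- The Levi-Civita connection is metric. -/
theorem dirDeriv_metricInner (hU : IsOpen U) (hx : x ∈ U) (V W₁ W₂ : VecField)
    (h₁ : ∀ i, DifferentiableAt ℝ (fun y => W₁ y i) x)
    (h₂ : ∀ i, DifferentiableAt ℝ (fun y => W₂ y i) x) :
    dirDeriv V (metricInner g W₁ W₂) x
      = metricInner g (covDeriv g V W₁) W₂ x + metricInner g W₁ (covDeriv g V W₂) x := by
  have hg : ∀ i j, DifferentiableAt ℝ (fun y => (g y i j : ℂ)) x := fun i j =>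
    ((contDiffOn_ofReal (hN.metric_smooth i j)).contDiffAt (hU.mem_nhds hx)).differentiableAt
      (by simp)
  have hL : dirDeriv V (metricInner g W₁ W₂) x = ∑ i, ∑ j,
      (dirDeriv V (fun y => (g y i j : ℂ)) x * W₁ x i * W₂ x j
        + g x i j * dirDeriv V (fun y => W₁ y i) x * W₂ x j
        + g x i j * W₁ x i * dirDeriv V (fun y => W₂ y j) x) := by
    unfold metricInner
    rw [dirDeriv_sum fun i _ => DifferentiableAt.fun_sum fun j _ =>
      ((hg i j).fun_mul (h₁ i)).fun_mul (h₂ j)]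
    refine Finset.sum_congr rfl fun i _ => ?_
    rw [dirDeriv_sum fun j _ => ((hg i j).fun_mul (h₁ i)).fun_mul (h₂ j)]
    refine Finset.sum_congr rfl fun j _ => ?_
    rw [dirDeriv_mul ((hg i j).fun_mul (h₁ i)) (h₂ j), dirDeriv_mul (hg i j) (h₁ i)]
    ring
  have hC : ∀ W : VecField, ∀ i, covDeriv g V W x i = dirDeriv V (fun y => W y i) x
      + ∑ k, (∑ j, (christoffel g i j k x : ℂ) * V x j) * W x k := fun W i => by
    simp only [covDeriv, Finset.sum_mul]
    rw [Finset.sum_comm]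
  rw [hL]
  simp only [hN.dirDeriv_metric hU hx, metricInner, hC]
  -- The Christoffel symbols enter only contracted with `V`; naming the contraction leaves an
  -- identity small enough for `ring`.
  obtain ⟨N, hN'⟩ : ∃ N : Fin 4 → Fin 4 → ℂ,
      ∀ i k, ∑ j, (christoffel g i j k x : ℂ) * V x j = N i k := ⟨_, fun _ _ => rfl⟩
  simp only [hN', Fin.sum_univ_four]
  ring

/-- The Levi-Civita connection is torsion-free. -/
theorem covDeriv_sub_covDeriv (hU : IsOpen U) (hx : x ∈ U) (V W : VecField) (i : Fin 4) :
    covDeriv g V W x i - covDeriv g W V x i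
      = dirDeriv V (fun y => W y i) x - dirDeriv W (fun y => V y i) x := by
  have h : ∑ j, ∑ k, (christoffel g i j k x : ℂ) * V x j * W x k
      = ∑ j, ∑ k, (christoffel g i j k x : ℂ) * W x j * V x k := by
    rw [Finset.sum_comm]
    refine Finset.sum_congr rfl fun j _ => Finset.sum_congr rfl fun k _ => ?_
    rw [hN.christoffel_symm hU hx]
    ring
  simp only [covDeriv, h]
  ring

theorem ofMetric_isAdmissibleOn (hU : IsOpen U) {Rm : Fin 4 → Fin 4 → Fin 4 → Fin 4 → Scalar}
    (hR : IsCurvatureFieldOn U Rm) : (Fields.ofMetric g t Rm).IsAdmissibleOn U where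
  tetrad_smooth := hN.tetrad_smooth
  conn_smooth := fun a b c => by
    change ContDiffOn ℝ ∞
      (fun x => ∑ i, ∑ j, (g x i j : ℂ) * t.e a x i * covDeriv g (t.e c) (t.e b) x j) U
    exact ContDiffOn.sum fun i _ => ContDiffOn.sum fun j _ =>
      ((contDiffOn_ofReal (hN.metric_smooth i j)).mul (hN.tetrad_smooth.e a i)).mul
        (hN.contDiffOn_covDeriv hU c b j)
  conn_antisymm := by
    intro x hx a b c
    have he : ∀ a i, DifferentiableAt ℝ (fun y => t.e a y i) x := fun a i =>
      ((hN.tetrad_smooth.e a i).contDiffAt (hU.mem_nhds hx)).differentiableAt (by simp)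
    have h := hN.dirDeriv_metricInner hU hx (t.e c) (t.e a) (t.e b) (he a) (he b)
    -- Tetrad inner products are constant on the open set, so metricity becomes antisymmetry of the
    -- coefficients.
    rw [dirDeriv_congr_of_isOpen hU hx (g := fun _ => eta a b)
      (fun y hy => hN.inner_eq y hy a b), dirDeriv_const] at h
    have hs : metricInner g (covDeriv g (t.e c) (t.e a)) (t.e b) x
        = metricInner g (t.e b) (covDeriv g (t.e c) (t.e a)) x := by
      simp only [metricInner]
      rw [Finset.sum_comm]
      refine Finset.sum_congr rfl fun j _ => Finset.sum_congr rfl fun k _ => ?_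
      rw [hN.metric_symm_apply hx]
      ring
    rw [hs] at h
    exact eq_neg_of_add_eq_zero_right h.symm
  conn_real := by
    intro x _ a b c
    simp only [Fields.ofMetric, star_metricInner, star_covDeriv, Fields.star_e]
  curv := hR

/-- Vanishing torsion turns the bracket into a difference of covariant derivatives; expanding each
in the frame gives the coefficients `comm`. -/
theorem ofMetric_commutatorsAt (hU : IsOpen U) (hx : x ∈ U)
    (Rm : Fin 4 → Fin 4 → Fin 4 → Fin 4 → Scalar) : (Fields.ofMetric g t Rm).CommutatorsAt x := by
  intro a b i
  have h := hN.covDeriv_sub_covDeriv hU hx (t.e a) (t.e b) i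
  have ha := hN.sum_frame hx (covDeriv g (t.e a) (t.e b)) i
  have hb := hN.sum_frame hx (covDeriv g (t.e b) (t.e a)) i
  simp only [Fields.comm, sub_mul, Finset.sum_sub_distrib]
  exact h.symm.trans (by rw [← ha, ← hb]; rfl)

end IsNullTetradOn

/-! ### The Bianchi equations and the vanishing of the defect when `κ ≠ 0` -/

namespace Fields

variable {F : Fields} {U : Set Coord} {x : Coord}

/-- Tetrad components `T_{abcf;h}` of the covariant derivative of a tensor field. -/
def cov4 (F : Fields) (T : Fin 4 → Fin 4 → Fin 4 → Fin 4 → Scalar) (a b c f h : Fin 4) : Scalar :=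
  fun x => F.d h (T a b c f) x
    - ∑ i, (F.Γup i a h x * T i b c f x + F.Γup i b h x * T a i c f x
        + F.Γup i c h x * T a b i f x + F.Γup i f h x * T a b c i x)

namespace IsAdmissibleOn

variable (hF : F.IsAdmissibleOn U)
include hF

theorem contDiffOn_d (hU : IsOpen U) {f : Scalar} (hf : ContDiffOn ℝ ∞ f U) (a : Fin 4) :
    ContDiffOn ℝ ∞ (F.d a f) U :=
  contDiffOn_dirDeriv hU (hF.tetrad_smooth.e a) hf

/-- The commutator relations determine the commutators of the derivations of scalars. -/
theorem d_d_sub_d_d (hU : IsOpen U) (hx : x ∈ U) (hc : F.CommutatorsAt x) {f : Scalar}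
    (hf : ContDiffOn ℝ ∞ f U) (a b : Fin 4) :
    F.d a (F.d b f) x - F.d b (F.d a f) x = ∑ c, F.comm c a b x * F.d c f x := by
  have hfx := hf.contDiffAt (hU.mem_nhds hx)
  have hsymm : IsSymmSndFDerivAt ℝ f x := hfx.isSymmSndFDerivAt (by
    rw [minSmoothness_of_isRCLikeNormedField]
    exact WithTop.coe_le_coe.mpr le_top)
  have hd : DifferentiableAt ℝ (fderiv ℝ f) x :=
    ((hf.fderiv_of_isOpen hU (m := ∞) (by simp)).contDiffAt
      (hU.mem_nhds hx)).differentiableAt (by simp)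
  have h2 : ∀ u v : Coord, fderiv ℝ (fun y => fderiv ℝ f y u) x v
      = fderiv ℝ (fderiv ℝ f) x v u := fun u v => by
    rw [(hd.hasFDerivAt.clm_apply (hasFDerivAt_const u x)).fderiv]
    simp
  have he : ∀ a i, DifferentiableAt ℝ (fun y => F.t.e a y i) x := fun a i =>
    ((hF.tetrad_smooth.e a i).contDiffAt (hU.mem_nhds hx)).differentiableAt (by simp)
  have hdd : ∀ i : Fin 4, DifferentiableAt ℝ (fun y => fderiv ℝ f y (Pi.single i 1)) x := fun i =>
    hd.clm_apply (differentiableAt_const _)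
  have key : ∀ a b, F.d a (F.d b f) x
      = ∑ i, (F.d a (fun y => F.t.e b y i) x * fderiv ℝ f x (Pi.single i 1)
        + F.t.e b x i * ∑ j, F.t.e a x j *
          fderiv ℝ (fderiv ℝ f) x (Pi.single j 1) (Pi.single i 1)) := fun a b => by
    have e : F.d b f = fun y => ∑ i, F.t.e b y i * fderiv ℝ f y (Pi.single i 1) := rfl
    rw [e, d, dirDeriv_sum fun i _ => (he b i).fun_mul (hdd i)]
    refine Finset.sum_congr rfl fun i _ => ?_
    rw [dirDeriv_mul (he b i) (hdd i)]
    congr 2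
    exact Finset.sum_congr rfl fun j _ => by rw [h2]
  have h3 : ∑ c, F.comm c a b x * F.d c f x
      = ∑ i, (F.d a (fun y => F.t.e b y i) x - F.d b (fun y => F.t.e a y i) x)
        * fderiv ℝ f x (Pi.single i 1) := by
    have h : ∀ c, F.d c f x = ∑ i, F.t.e c x i * fderiv ℝ f x (Pi.single i 1) := fun _ => rfl
    simp only [hc a b, h, Finset.mul_sum, Finset.sum_mul]
    rw [Finset.sum_comm]
    exact Finset.sum_congr rfl fun _ _ => Finset.sum_congr rfl fun _ _ => by ring
  -- Symmetry of the second derivative cancels the second-order terms, leaving only derivatives of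
  -- the frame.
  have h4 : ∑ i, F.t.e b x i * ∑ j, F.t.e a x j *
          fderiv ℝ (fderiv ℝ f) x (Pi.single j 1) (Pi.single i 1)
      = ∑ i, F.t.e a x i * ∑ j, F.t.e b x j *
          fderiv ℝ (fderiv ℝ f) x (Pi.single j 1) (Pi.single i 1) := by
    simp only [Finset.mul_sum]
    rw [Finset.sum_comm]
    refine Finset.sum_congr rfl fun i _ => Finset.sum_congr rfl fun j _ => ?_
    rw [hsymm (Pi.single i 1) (Pi.single j 1)]
    ring
  rw [key, key, h3]
  simp only [Finset.sum_add_distrib, sub_mul, Finset.sum_sub_distrib]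
  rw [h4]
  ring

theorem contDiffOn_Γup (a b c : Fin 4) : ContDiffOn ℝ ∞ (F.Γup a b c) U :=
  ContDiffOn.sum fun h _ => contDiffOn_const.mul (hF.conn_smooth h b c)

theorem contDiffOn_comm (a b c : Fin 4) : ContDiffOn ℝ ∞ (F.comm a b c) U :=
  (hF.contDiffOn_Γup a c b).sub (hF.contDiffOn_Γup a b c)

theorem contDiffOn_cartan (hU : IsOpen U) (a b c f : Fin 4) :
    ContDiffOn ℝ ∞ (F.cartan a b c f) U :=
  ((hF.contDiffOn_d hU (hF.conn_smooth a b f) c).sub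
    (hF.contDiffOn_d hU (hF.conn_smooth a b c) f)).add
    (ContDiffOn.sum fun h _ => (((hF.contDiffOn_Γup h b f).mul (hF.conn_smooth a h c)).sub
      ((hF.contDiffOn_Γup h b c).mul (hF.conn_smooth a h f))).sub
      ((hF.contDiffOn_comm h c f).mul (hF.conn_smooth a b h)))

theorem d_cartan (hU : IsOpen U) (hx : x ∈ U) (l a b c f : Fin 4) :
    F.d l (F.cartan a b c f) x = F.d l (F.d c (F.Γ a b f)) x - F.d l (F.d f (F.Γ a b c)) x
      + ∑ h, (F.d l (F.Γup h b f) x * F.Γ a h c x + F.Γup h b f x * F.d l (F.Γ a h c) x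
        - (F.d l (F.Γup h b c) x * F.Γ a h f x + F.Γup h b c x * F.d l (F.Γ a h f) x)
        - (F.d l (F.comm h c f) x * F.Γ a b h x + F.comm h c f x * F.d l (F.Γ a b h) x)) := by
  have D : ∀ {f : Scalar}, ContDiffOn ℝ ∞ f U → DifferentiableAt ℝ f x := fun h =>
    (h.contDiffAt (hU.mem_nhds hx)).differentiableAt (by simp)
  have h1 := fun a b c f => D (hF.contDiffOn_d hU (hF.conn_smooth a b c) f)
  have h2 := fun a b c => D (hF.conn_smooth a b c)
  have h3 := fun a b c => D (hF.contDiffOn_Γup a b c)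
  have h4 := fun a b c => D (hF.contDiffOn_comm a b c)
  have h5 : ∀ h, DifferentiableAt ℝ (fun y => F.Γup h b f y * F.Γ a h c y) x := fun h =>
    (h3 h b f).fun_mul (h2 a h c)
  have h6 : ∀ h, DifferentiableAt ℝ (fun y => F.Γup h b c y * F.Γ a h f y) x := fun h =>
    (h3 h b c).fun_mul (h2 a h f)
  have h7 : ∀ h, DifferentiableAt ℝ (fun y => F.comm h c f y * F.Γ a b h y) x := fun h =>
    (h4 h c f).fun_mul (h2 a b h)
  have e : F.cartan a b c f = fun y => (F.d c (F.Γ a b f) y - F.d f (F.Γ a b c) y)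
    + ∑ h, ((F.Γup h b f y * F.Γ a h c y - F.Γup h b c y * F.Γ a h f y)
        - F.comm h c f y * F.Γ a b h y) := rfl
  rw [e, d, dirDeriv_add ((h1 _ _ _ _).fun_sub (h1 _ _ _ _))
    (DifferentiableAt.fun_sum fun h _ => ((h5 h).fun_sub (h6 h)).fun_sub (h7 h)),
    dirDeriv_sub (h1 _ _ _ _) (h1 _ _ _ _),
    dirDeriv_sum fun h _ => ((h5 h).fun_sub (h6 h)).fun_sub (h7 h)]
  congr 1
  refine Finset.sum_congr rfl fun h _ => ?_
  rw [dirDeriv_sub ((h5 h).fun_sub (h6 h)) (h7 h), dirDeriv_sub (h5 h) (h6 h),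
    dirDeriv_mul (h3 _ _ _) (h2 _ _ _), dirDeriv_mul (h3 _ _ _) (h2 _ _ _),
    dirDeriv_mul (h4 _ _ _) (h2 _ _ _)]
  rfl

set_option maxHeartbeats 4000000 in
set_option maxRecDepth 10000 in
/-- The Bianchi identity for the curvature of the connection. -/
theorem bianchi_cartan (hU : IsOpen U) (hx : x ∈ U) (hc : F.CommutatorsAt x)
    (hJ : F.JacobiAt x) (a b c f h : Fin 4) :
    F.cov4 F.cartan a b c f h x + F.cov4 F.cartan a b f h c x + F.cov4 F.cartan a b h c f x
      = 0 := by
  have g := hF.conn_antisymm x hx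
  -- In the cyclic sum, second derivatives of `Γ` pair into these three commutators, while
  -- derivatives of the commutation coefficients form the Jacobi expressions contracted with `F.Γ a
  -- b`.
  have s1 := hF.d_d_sub_d_d hU hx hc (hF.conn_smooth a b f) h c
  have s2 := hF.d_d_sub_d_d hU hx hc (hF.conn_smooth a b h) c f
  have s3 := hF.d_d_sub_d_d hU hx hc (hF.conn_smooth a b c) f h
  have j0 := hJ c f h 0
  have j1 := hJ c f h 1
  have j2 := hJ c f h 2
  have j3 := hJ c f h 3
  have hneg : ∀ h a b c, F.d h (fun y => -F.Γ a b c y) x = -F.d h (F.Γ a b c) x :=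
    fun h a b c => dirDeriv_neg _ _ _
  -- Antisymmetry is instantiated at the fixed outer index `a`, so that only coefficients containing
  -- it are reordered.
  have g0 : ∀ c, F.Γ 0 a c x = -F.Γ a 0 c x := fun c => g _ _ _
  have g1 : ∀ c, F.Γ 1 a c x = -F.Γ a 1 c x := fun c => g _ _ _
  have g2 : ∀ c, F.Γ 2 a c x = -F.Γ a 2 c x := fun c => g _ _ _
  have g3 : ∀ c, F.Γ 3 a c x = -F.Γ a 3 c x := fun c => g _ _ _
  have hcm : ∀ c a b, F.comm c a b x = F.Γup c b a x - F.Γup c a b x := fun _ _ _ => rfl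
  simp only [Fin.sum_univ_four, hcm, Γup_zero, Γup_one, Γup_two, Γup_three]
    at s1 s2 s3 j0 j1 j2 j3
  simp only [cov4, hF.d_cartan hU hx]
  simp only [cartan, Fin.sum_univ_four, hcm, Γup_zero, Γup_one, Γup_two, Γup_three, hneg]
  simp only [g0, g1, g2, g3]
  linear_combination s1 + s2 + s3 - F.Γ a b 0 x * j0 - F.Γ a b 1 x * j1 - F.Γ a b 2 x * j2
    - F.Γ a b 3 x * j3

end IsAdmissibleOn

theorem cov4_sub {T S : Fin 4 → Fin 4 → Fin 4 → Fin 4 → Scalar}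
    (hT : ∀ a b c f, DifferentiableAt ℝ (T a b c f) x)
    (hS : ∀ a b c f, DifferentiableAt ℝ (S a b c f) x) (a b c f h : Fin 4) :
    F.cov4 (fun a b c f y => T a b c f y - S a b c f y) a b c f h x
      = F.cov4 T a b c f h x - F.cov4 S a b c f h x := by
  simp only [cov4, d, dirDeriv_sub (hT a b c f) (hS a b c f), Fin.sum_univ_four]
  ring

/-- A tensor field satisfying the Bianchi equations and annihilated by `k` in its last two slots and
by `X` in its first slot is annihilated by `∇_k X` in its first slot. -/
theorem sum_cov1_mul_eq_zero (hU : IsOpen U) {S : Fin 4 → Fin 4 → Fin 4 → Fin 4 → Scalar}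
    (hS : ∀ x ∈ U, ∀ a b c f, DifferentiableAt ℝ (S a b c f) x)
    (hB : ∀ x ∈ U, ∀ a b c f h,
      F.cov4 S a b c f h x + F.cov4 S a b f h c x + F.cov4 S a b h c f x = 0)
    (h3 : ∀ x ∈ U, ∀ a b c, S a b c 3 x = 0) (h3' : ∀ x ∈ U, ∀ a b c, S a b 3 c x = 0)
    {X : Fin 4 → Scalar} (hXd : ∀ x ∈ U, ∀ a, DifferentiableAt ℝ (X a) x)
    (hX : ∀ x ∈ U, ∀ b c f, ∑ a, X a x * S a b c f x = 0) :
    ∀ x ∈ U, ∀ b c f, ∑ a, F.cov1 X a 3 x * S a b c f x = 0 := by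
  intro x hx b c f
  have hD : ∑ a, (F.d 3 (X a) x * S a b c f x + X a x * F.d 3 (S a b c f) x) = 0 := by
    have h := dirDeriv_congr_of_isOpen (v := F.t.e 3) hU hx (g := fun _ => 0)
      (fun y hy => hX y hy b c f)
    rw [dirDeriv_const, dirDeriv_sum fun a _ => (hXd x hx a).fun_mul (hS x hx a b c f)] at h
    rw [← h]
    exact Finset.sum_congr rfl fun a _ => (dirDeriv_mul (hXd x hx a) (hS x hx a b c f)).symm
  -- Components with `k` in a last slot vanish throughout `U`, hence so do their derivatives. The
  -- connection terms in their covariant derivatives need not vanish.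
  have hd : ∀ a b c l, F.d l (S a b c 3) x = 0 := fun a b c l =>
    (dirDeriv_congr_of_isOpen hU hx fun y hy => h3 y hy a b c).trans (dirDeriv_const _ 0 _)
  have hd' : ∀ a b c l, F.d l (S a b 3 c) x = 0 := fun a b c l =>
    (dirDeriv_congr_of_isOpen hU hx fun y hy => h3' y hy a b c).trans (dirDeriv_const _ 0 _)
  have hB' : ∑ a, X a x * (F.cov4 S a b c f 3 x + F.cov4 S a b f 3 c x + F.cov4 S a b 3 c f x)
      = 0 := by simp only [hB x hx, mul_zero, Finset.sum_const_zero]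
  replace hX := hX x hx
  simp only [cov4, hd, hd', h3 x hx, h3' x hx, Fin.sum_univ_four, mul_zero, add_zero, zero_add,
    zero_sub] at hB' hD hX
  simp only [cov1, Fin.sum_univ_four]
  -- Differentiating `X` along `k` together with the connection acting on the first slot produces
  -- `∇_k X`. Every other connection term still has its first slot contracted with `X`, and is
  -- removed by an instance of `hX`.
  linear_combination hD - hB' -
    (F.Γup 0 b 3 x * hX 0 c f + F.Γup 0 c 3 x * hX b 0 f +
      F.Γup 0 f 3 x * hX b c 0 + F.Γup 0 3 c x * hX b f 0 +
      F.Γup 0 3 f x * hX b 0 c +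
      F.Γup 1 b 3 x * hX 1 c f + F.Γup 1 c 3 x * hX b 1 f +
      F.Γup 1 f 3 x * hX b c 1 + F.Γup 1 3 c x * hX b f 1 +
      F.Γup 1 3 f x * hX b 1 c +
      F.Γup 2 b 3 x * hX 2 c f + F.Γup 2 c 3 x * hX b 2 f +
      F.Γup 2 f 3 x * hX b c 2 + F.Γup 2 3 c x * hX b f 2 +
      F.Γup 2 3 f x * hX b 2 c +
      F.Γup 3 b 3 x * hX 3 c f)

namespace IsAdmissibleOn

variable (hF : F.IsAdmissibleOn U)
include hF

theorem defect_differentiableAt (hU : IsOpen U) (hx : x ∈ U) (a b c f : Fin 4) :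
    DifferentiableAt ℝ (F.defect a b c f) x :=
  (((hF.curv.smooth a b c f).sub (hF.contDiffOn_cartan hU a b c f)).contDiffAt
    (hU.mem_nhds hx)).differentiableAt (by simp)

theorem bianchi_defect (hU : IsOpen U) (hx : x ∈ U) (hc : F.CommutatorsAt x)
    (hJ : F.JacobiAt x) (hB : F.BianchiAt x) (a b c f h : Fin 4) :
    F.cov4 F.defect a b c f h x + F.cov4 F.defect a b f h c x + F.cov4 F.defect a b h c f x
      = 0 := by
  have hs : ∀ a b c f h, F.cov4 F.defect a b c f h x
      = F.cov4 F.Rm a b c f h x - F.cov4 F.cartan a b c f h x := fun a b c f h =>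
    cov4_sub
      (fun a b c f => ((hF.curv.smooth a b c f).contDiffAt
        (hU.mem_nhds hx)).differentiableAt (by simp))
      (fun a b c f => ((hF.contDiffOn_cartan hU a b c f).contDiffAt
        (hU.mem_nhds hx)).differentiableAt (by simp)) a b c f h
  have hR : F.cov4 F.Rm a b c f h x + F.cov4 F.Rm a b f h c x + F.cov4 F.Rm a b h c f x = 0 :=
    hB a b c f h
  rw [hs, hs, hs]
  linear_combination hR - hF.bianchi_cartan hU hx hc hJ a b c f h

/-- A defect annihilated by `k` in its second slot is annihilated by `k` in its last slot. -/
theorem defect_last_eq_zero (hU : IsOpen U) (hx : x ∈ U) (hJ : F.JacobiAt x)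
    (hR : F.RicciAt x) (a b c : Fin 4) : F.defect a b c 3 x = 0 := by
  have l := hF.defect_antisymm_left hU hx
  have r := hF.defect_antisymm_right hx
  have cyc := (hF.jacobiAt_iff_defect hU hx).mp hJ
  have k := ricciAt_iff_defect.mp hR
  -- The cyclic identity loses its term with `k` in the second slot. What remains is symmetry in
  -- slots two and three, incompatible with antisymmetry in slots one and two unless the component
  -- is zero.
  have s : ∀ a b c, F.defect a b c 3 x = F.defect a c b 3 x := fun a b c => by
    linear_combination cyc a b c 3 - k a b c - r a c 3 b
  have h : F.defect a b c 3 x = -F.defect a b c 3 x := by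
    calc F.defect a b c 3 x = F.defect a c b 3 x := s _ _ _
      _ = -F.defect c a b 3 x := l _ _ _ _
      _ = -F.defect c b a 3 x := by rw [s]
      _ = F.defect b c a 3 x := by rw [l c b, neg_neg]
      _ = F.defect b a c 3 x := s _ _ _
      _ = -F.defect a b c 3 x := l _ _ _ _
  linear_combination (1 / 2) * h

/-- If `κ ≠ 0`, then the Jacobi, Ricci and Bianchi equations imply the second Cartan equations:
the defect is annihilated by `k`, `∇_k k` and `∇_k ∇_k k`. -/
theorem cartanAt_of_kappa_ne_zero (hU : IsOpen U) (hc : ∀ x ∈ U, F.CommutatorsAt x)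
    (hκ : ∀ x ∈ U, F.κ x ≠ 0) (hJ : ∀ x ∈ U, F.JacobiAt x) (hR : ∀ x ∈ U, F.RicciAt x)
    (hB : ∀ x ∈ U, F.BianchiAt x) (hx : x ∈ U) : F.CartanAt x := by
  have hS := fun (y : Coord) (hy : y ∈ U) => hF.defect_differentiableAt hU hy
  have hSB := fun (y : Coord) (hy : y ∈ U) =>
    hF.bianchi_defect hU hy (hc y hy) (hJ y hy) (hB y hy)
  have h3 := fun (y : Coord) (hy : y ∈ U) => hF.defect_last_eq_zero hU hy (hJ y hy) (hR y hy)
  have h3' : ∀ y ∈ U, ∀ a b c, F.defect a b 3 c y = 0 := fun y hy a b c => by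
    rw [hF.defect_antisymm_right hy, h3 y hy, neg_zero]
  have hk : ∀ y ∈ U, ∀ b c f, F.defect 3 b c f y = 0 := fun y hy b c f => by
    rw [hF.defect_antisymm_left hU hy, ricciAt_iff_defect.mp (hR y hy), neg_zero]
  -- Here `∇_k k` is `-κ̄ m - κ m̄` plus a multiple of `k`. The result is kept on all of `U` because
  -- it is differentiated once more.
  have h1 : ∀ y ∈ U, ∀ b c f, ∑ a, F.Γup a 3 3 y * F.defect a b c f y = 0 := by
    have h := sum_cov1_mul_eq_zero (F := F) hU hS hSB h3 h3' (X := kComp)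
      (fun _ _ _ => differentiableAt_const _) (fun y hy b c f => by simp [kComp, hk y hy])
    simpa only [cov1_kComp] using h
  have h2 := sum_cov1_mul_eq_zero (F := F) hU hS hSB h3 h3' (X := fun a => F.Γup a 3 3)
    (fun y hy a => ((hF.contDiffOn_Γup a 3 3).contDiffAt (hU.mem_nhds hy)).differentiableAt
      (by simp)) h1 x hx
  replace h1 := h1 x hx
  replace hk := hk x hx
  have g := hF.conn_antisymm x hx
  have g33 : ∀ y ∈ U, F.Γ 3 3 3 y = 0 := fun y hy => by
    linear_combination (1 / 2) * hF.conn_antisymm y hy 3 3 3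
  -- The `ℓ`-component of `∇_k ∇_k k` is `2 κ κ̄`; being nonzero, it makes this vector independent
  -- of `k` and `∇_k k`.
  have hl : F.cov1 (fun a => F.Γup a 3 3) 2 3 x = 2 * F.Γ 0 3 3 x * F.Γ 1 3 3 x := by
    have hd : F.d 3 (fun y => -F.Γ 3 3 3 y) x = 0 :=
      (dirDeriv_congr_of_isOpen hU hx fun y hy => by
        rw [g33 y hy, neg_zero]).trans (dirDeriv_const _ 0 _)
    simp only [cov1, hd, Fin.sum_univ_four, Γup_zero, Γup_one, Γup_two, Γup_three, g33 x hx]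
    rw [g 3 0 3, g 3 1 3]
    ring
  have hκ0 : F.Γ 0 3 3 x ≠ 0 := fun h => hκ x hx (by simp [κ, h])
  have hκ1 : F.Γ 1 3 3 x ≠ 0 := fun h => hκ0 (by
    have := hF.conn_real x hx 1 3 3
    rw [h, star_zero] at this
    exact this.symm)
  have l := hF.defect_antisymm_left hU hx
  have e1 : ∀ b c f, F.defect 1 b c f x
      = -(F.Γ 1 3 3 x / F.Γ 0 3 3 x) * F.defect 0 b c f x := fun b c f => by
    have h := h1 b c f
    simp only [Fin.sum_univ_four, Γup_zero, Γup_one, Γup_two, hk, g33 x hx] at h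
    field_simp
    linear_combination h
  obtain ⟨r, e2⟩ : ∃ r : ℂ, ∀ b c f, F.defect 2 b c f x = r * F.defect 0 b c f x := by
    refine ⟨-(F.cov1 (fun a => F.Γup a 3 3) 0 3 x - F.cov1 (fun a => F.Γup a 3 3) 1 3 x *
      (F.Γ 1 3 3 x / F.Γ 0 3 3 x)) / (2 * F.Γ 0 3 3 x * F.Γ 1 3 3 x), fun b c f => ?_⟩
    have h := h2 b c f
    simp only [Fin.sum_univ_four, hk, hl, e1] at h
    rw [div_mul_eq_mul_div, eq_div_iff (by simp [hκ0, hκ1])]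
    linear_combination h
  have e00 : ∀ c f, F.defect 0 0 c f x = 0 := fun c f => by
    linear_combination (1 / 2) * l 0 0 c f
  -- All components are now multiples of those with first index `0`. Swapping the first two indices
  -- reduces these in turn to `F.defect 0 0`, which is zero.
  have e0 : ∀ b c f, F.defect 0 b c f x = 0 := fun b c f => by
    rw [l]
    fin_cases b
    · simp [e00]
    · simp [e1, e00]
    · simp [e2, e00]
    · simp [hk]
  rw [cartanAt_iff_defect]
  intro a b c f
  fin_cases a
  · exact e0 b c f
  · simp [e1, e0]
  · simp [e2, e0]
  · exact hk b c f

end IsAdmissibleOn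

end Fields

end NewmanPenrose

end

open NewmanPenrose in
theorem theorem3 :
    -- The Newman-Penrose equations are the second Cartan equations; their Jacobi and Ricci parts
    -- are the Jacobi equations and the Ricci equations for `k`, and what is left of them after
    -- these two parts are the equations NP10, NP13, Re NP12, Re NP14.
    (∀ (U : Set Coord) (F : Fields), IsOpen U → F.IsAdmissibleOn U → ∀ x ∈ U,
      (F.CartanAt x ↔ F.AllNPAt x) ∧
      (F.JacobiAt x ↔ F.JacobiNPAt x) ∧
      (F.RicciAt x ↔ F.RicciNPAt x) ∧
      (F.AllNPAt x ↔ F.JacobiNPAt x ∧ F.RicciNPAt x ∧ F.FieldNPAt x)) ∧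
    -- If `κ ≠ 0`, each solution of the remaining Newman-Penrose equations and the Bianchi equations
    -- satisfies NP10, NP13, Re NP12, Re NP14.
    (∀ (U : Set Coord) (g : Coord → Matrix (Fin 4) (Fin 4) ℝ) (t : Tetrad)
      (Rm : Fin 4 → Fin 4 → Fin 4 → Fin 4 → Scalar), IsOpen U →
      IsNullTetradOn U g t → IsCurvatureFieldOn U Rm →
      (∀ x ∈ U, (Fields.ofMetric g t Rm).κ x ≠ 0) →
      (∀ x ∈ U, (Fields.ofMetric g t Rm).JacobiNPAt x) →
      (∀ x ∈ U, (Fields.ofMetric g t Rm).RicciNPAt x) →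
      (∀ x ∈ U, (Fields.ofMetric g t Rm).BianchiAt x) →
      ∀ x ∈ U, (Fields.ofMetric g t Rm).FieldNPAt x) ∧
    -- They are not algebraic consequences of these equations: at a point where the commutator
    -- relations, the remaining Newman-Penrose equations and the Bianchi equations hold and
    -- `κ ≠ 0`, the left-hand sides can have arbitrary values. So they arise by differentiation.
    (∀ (a b : ℂ) (c d : ℝ), ∃ (F : Fields) (x : Coord),
      F.IsAdmissibleOn Set.univ ∧ LinearIndependent ℂ (fun i => F.t.e i x) ∧ F.κ x ≠ 0 ∧
      F.CommutatorsAt x ∧ F.JacobiNPAt x ∧ F.RicciNPAt x ∧ F.BianchiAt x ∧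
      F.NP10 x = a ∧ F.NP13 x = b ∧
      (F.NP12 + star F.NP12) x = c ∧ (F.NP14 + star F.NP14) x = d) := by
  refine ⟨fun U F hU hF x hx => ⟨hF.cartanAt_iff_allNPAt hU hx, hF.jacobiAt_iff_jacobiNPAt hU hx,
    hF.ricciAt_iff_ricciNPAt hU hx, Fields.allNPAt_iff⟩, ?_, exists_isAdmissibleOn_fieldNP⟩
  intro U g t Rm hU hN hRm hκ hJ hR hB x hx
  have hF := hN.ofMetric_isAdmissibleOn hU hRm
  have hC := hF.cartanAt_of_kappa_ne_zero hU (fun y hy => hN.ofMetric_commutatorsAt hU hy Rm) hκ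
    (fun y hy => (hF.jacobiAt_iff_jacobiNPAt hU hy).mpr (hJ y hy))
    (fun y hy => (hF.ricciAt_iff_ricciNPAt hU hy).mpr (hR y hy)) hB hx
  exact (Fields.allNPAt_iff.mp ((hF.cartanAt_iff_allNPAt hU hx).mp hC)).2.2
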